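/- Let $K$ be a field and let $E=(E^0,E^1,s,r)$ be a directed graph with finitely many vertices (and an arbitrary set of edges). Let $L_K(E)$ be the Leavitt path algebra of $E$, i.e. the $K$-algebra generated by the symbols $u\in E^0$, $f$ and $f^*$ ($f\in E^1$) subject to the relations, for all $u,u'\in E^0$ and $f,g\in E^1$: (1) $uu'=\delta_{u,u'}u$; (2) $s(f)f=f=f\,r(f)$ and $f^*s(f)=f^*=r(f)f^*$; (3) $f^*g=\delta_{f,g}\,r(f)$; (4) $u=\sum_{f\in s^{-1}(u)}ff^*$ whenever $0<|s^{-1}(u)|<\infty$. It is unital with $1=\sum_{u\in E^0}u$. Let $n$ be a positive integer, let $v$ and $w$ be vertices of $E$ (possibly equal), and let $e_1,\dots,e_n$ be distinct edges of $E$ with $s(e_i)=v$ and $r(e_i)=w$ for all $i$. Let $P=(p_{i,j})$ be a unit of the matrix ring $M_n(L_K(E))$ with $wP=Pw$ (that is, $wp_{i,j}=p_{i,j}w$ for all $i,j$), and write $P^{-1}=(q_{i,j})$. Then the following hold. (i) There is a unique homomorphism of $K$-algebras $\phi_P\colon L_K(E)\to L_K(E)$ such that $\phi_P(u)=u$ for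 all $u\in E^0$, $\phi_P(f)=f$ and $\phi_P(f^*)=f^*$ for all $f\in E^1\setminus\{e_1,\dots,e_n\}$, and $$\phi_P(e_i)=\sum_{k=1}^n e_kp_{k,i},\qquad \phi_P(e_i^*)=\sum_{k=1}^n q_{i,k}e_k^*\qquad (1\le i\le n).$$ (ii) If $\phi_P(p_{i,j})=p_{i,j}$ for all $1\le i,j\le n$, then $\phi_P$ is an isomorphism and $\phi_P^{-1}=\phi_{P^{-1}}$ (the homomorphism obtained from $P^{-1}$ in place of $P$ as in (i)). -/

import Mathlib

universe u v w

/-- A directed graph with set of vertices `V`, set of edges `E`, and source and range maps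
`s, r : E → V`.  Multiple edges and loops are allowed, and `V` and `E` are arbitrary. -/
structure DirectedGraph (V : Type u) (E : Type v) where
  /-- the source of an edge -/
  s : E → V
  /-- the range of an edge -/
  r : E → V

namespace DirectedGraph

variable {V : Type u} {E : Type v}

/-- The generators of a Leavitt path algebra: the vertices, the edges `e` and a disjoint copy of the
edges, whose elements are the symbols `e*`. -/
inductive Generator (V : Type u) (E : Type v) : Type (max u v)
  | vertex : V → Generator V E
  | edge : E → Generator V E
  | ghost : E → Generator V E

/-- The free associative (not necessarily unital) `K`-algebra on the generators: its `K`-basis is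
the set of nonempty words in the generators. -/
abbrev FreeAlg (K : Type w) [Field K] (V : Type u) (E : Type v) : Type (max u v w) :=
  MonoidAlgebra K (FreeSemigroup (Generator V E))

/-- A generator, as an element of the free algebra. -/
noncomputable def FreeAlg.gen (K : Type w) [Field K] (x : Generator V E) : FreeAlg K V E :=
  MonoidAlgebra.single (FreeSemigroup.of x) 1

open Generator FreeAlg in
/-- The defining relations of the Leavitt path algebra of `G`. In the last one `u` is a regular
vertex, that is, the set of the edges with source `u` is finite and nonempty. -/
inductive LeavittRel (K : Type w) [Field K] (G : DirectedGraph V E) :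
    FreeAlg K V E → FreeAlg K V E → Prop
  | vertex_mul_self (u : V) :
      LeavittRel K G (gen K (vertex u) * gen K (vertex u)) (gen K (vertex u))
  | vertex_mul_vertex (u u' : V) (h : u ≠ u') :
      LeavittRel K G (gen K (vertex u) * gen K (vertex u')) 0
  | source_mul_edge (e : E) :
      LeavittRel K G (gen K (vertex (G.s e)) * gen K (edge e)) (gen K (edge e))
  | edge_mul_range (e : E) :
      LeavittRel K G (gen K (edge e) * gen K (vertex (G.r e))) (gen K (edge e))
  | ghost_mul_source (e : E) :
      LeavittRel K G (gen K (ghost e) * gen K (vertex (G.s e))) (gen K (ghost e))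
  | range_mul_ghost (e : E) :
      LeavittRel K G (gen K (vertex (G.r e)) * gen K (ghost e)) (gen K (ghost e))
  | ghost_mul_self (e : E) :
      LeavittRel K G (gen K (ghost e) * gen K (edge e)) (gen K (vertex (G.r e)))
  | ghost_mul_edge (e f : E) (h : e ≠ f) :
      LeavittRel K G (gen K (ghost e) * gen K (edge f)) 0
  | regular (u : V) (hfin : {e : E | G.s e = u}.Finite) (hne : {e : E | G.s e = u}.Nonempty) :
      LeavittRel K G (gen K (vertex u))
        (∑ e ∈ hfin.toFinset, gen K (edge e) * gen K (ghost e))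

/-- The smallest congruence of the `K`-algebra `FreeAlg K V E` containing the defining relations:
the smallest ring congruence containing all `K`-multiples of the relations. -/
noncomputable def leavittCon (K : Type w) [Field K] (G : DirectedGraph V E) :
    RingCon (FreeAlg K V E) :=
  ringConGen fun x y => ∃ (c : K) (a b : FreeAlg K V E), LeavittRel K G a b ∧ x = c • a ∧ y = c • b

theorem leavittCon_of_rel {K : Type w} [Field K] {G : DirectedGraph V E} {a b : FreeAlg K V E}
    (h : LeavittRel K G a b) : leavittCon K G a b :=
  RingConGen.Rel.of _ _ ⟨1, a, b, h, by simp, by simp⟩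

theorem leavittCon_smul {K : Type w} [Field K] {G : DirectedGraph V E} (c : K)
    {a b : FreeAlg K V E} (h : leavittCon K G a b) : leavittCon K G (c • a) (c • b) := by
  have h' : RingConGen.Rel _ a b := h
  change RingConGen.Rel _ (c • a) (c • b)
  clear h
  induction h' with
  | of x y h =>
    obtain ⟨d, x', y', h, rfl, rfl⟩ := h
    exact .of _ _ ⟨c * d, x', y', h, by rw [mul_smul], by rw [mul_smul]⟩
  | refl x => exact .refl _
  | symm _ ih => exact .symm ih
  | trans _ _ ih₁ ih₂ => exact .trans ih₁ ih₂
  | add _ _ ih₁ ih₂ => simpa only [smul_add] using .add ih₁ ih₂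
  | mul _ h₂ ih₁ _ =>
    rw [← smul_mul_assoc, ← smul_mul_assoc]
    exact .mul ih₁ h₂

/-- The Leavitt path algebra `L_K(G)` of the directed graph `G` with coefficients in `K`: the
(associative, not necessarily unital) `K`-algebra given by the generators `u`, `e`, `e*` and the
relations `LeavittRel`. -/
def LeavittPathAlgebra (K : Type w) [Field K] (G : DirectedGraph V E) : Type (max u v w) :=
  (leavittCon K G).Quotient

namespace LeavittPathAlgebra

variable (K : Type w) [Field K] (G : DirectedGraph V E)

noncomputable instance instNonUnitalRing : NonUnitalRing (LeavittPathAlgebra K G) :=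
  inferInstanceAs (NonUnitalRing (leavittCon K G).Quotient)

/-- The quotient map from the free algebra to the Leavitt path algebra. -/
noncomputable def mk (x : FreeAlg K V E) : LeavittPathAlgebra K G :=
  RingCon.toQuotient (c := leavittCon K G) x

theorem mk_surjective : Function.Surjective (mk K G) := Quotient.mk''_surjective

theorem mk_add (x y : FreeAlg K V E) : mk K G (x + y) = mk K G x + mk K G y := rfl

theorem mk_mul (x y : FreeAlg K V E) : mk K G (x * y) = mk K G x * mk K G y := rfl

theorem mk_zero : mk K G 0 = 0 := rfl

theorem mk_eq_of_rel {a b : FreeAlg K V E} (h : LeavittRel K G a b) : mk K G a = mk K G b :=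
  (RingCon.eq _).2 (leavittCon_of_rel h)

noncomputable instance instSMul : SMul K (LeavittPathAlgebra K G) where
  smul c := Quotient.map' (c • ·) fun _ _ h => leavittCon_smul c h

theorem mk_smul (c : K) (x : FreeAlg K V E) : mk K G (c • x) = c • mk K G x := rfl

noncomputable instance instModule : Module K (LeavittPathAlgebra K G) :=
  Function.Surjective.module K
    { toFun := mk K G, map_zero' := mk_zero K G, map_add' := mk_add K G }
    (mk_surjective K G) (mk_smul K G)

instance instIsScalarTower :
    IsScalarTower K (LeavittPathAlgebra K G) (LeavittPathAlgebra K G) where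
  smul_assoc c x y := by
    obtain ⟨x, rfl⟩ := mk_surjective K G x
    obtain ⟨y, rfl⟩ := mk_surjective K G y
    simp only [smul_eq_mul, ← mk_smul, ← mk_mul, smul_mul_assoc]

instance instSMulCommClass :
    SMulCommClass K (LeavittPathAlgebra K G) (LeavittPathAlgebra K G) where
  smul_comm c x y := by
    obtain ⟨x, rfl⟩ := mk_surjective K G x
    obtain ⟨y, rfl⟩ := mk_surjective K G y
    simp only [smul_eq_mul, ← mk_smul, ← mk_mul, mul_smul_comm]

/-- The element `u` of the Leavitt path algebra, for a vertex `u`. -/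
noncomputable def vertex (u : V) : LeavittPathAlgebra K G := mk K G (FreeAlg.gen K (.vertex u))

/-- The element `e` of the Leavitt path algebra, for an edge `e`. -/
noncomputable def edge (e : E) : LeavittPathAlgebra K G := mk K G (FreeAlg.gen K (.edge e))

/-- The element `e*` of the Leavitt path algebra, for an edge `e`. -/
noncomputable def ghost (e : E) : LeavittPathAlgebra K G := mk K G (FreeAlg.gen K (.ghost e))

theorem gen_induction {K : Type w} [Field K] {G : DirectedGraph V E}
    {p : LeavittPathAlgebra K G → Prop} (x : LeavittPathAlgebra K G)
    (gen : ∀ g, p (mk K G (FreeAlg.gen K g))) (mul : ∀ x y, p x → p y → p (x * y))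
    (add : ∀ x y, p x → p y → p (x + y)) (smul : ∀ (c : K) x, p x → p (c • x)) (zero : p 0) :
    p x := by
  obtain ⟨x, rfl⟩ := mk_surjective K G x
  induction x using MonoidAlgebra.induction_linear with
  | zero => exact zero
  | add x y hx hy => exact add _ _ hx hy
  | single m c =>
    have h : p (mk K G (MonoidAlgebra.single m 1)) := by
      induction m using FreeSemigroup.recOnMul with
      | ih1 g => exact gen g
      | ih2 g m hg hm =>
        have := mul _ _ hg hm
        rwa [← mk_mul, MonoidAlgebra.single_mul_single, one_mul] at this
    have := smul c _ h
    rwa [← mk_smul, MonoidAlgebra.smul_single, smul_eq_mul, mul_one] at this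

/-! If the graph has finitely many vertices, then the sum of the vertices is an identity. -/

section Unital

variable [Fintype V]

theorem sum_vertex_mul_eq {x : LeavittPathAlgebra K G} (u : V) (h : vertex K G u * x = x) :
    (∑ u', vertex K G u') * x = x := by
  rw [← h, ← mul_assoc, Finset.sum_mul, Finset.sum_eq_single u]
  · exact congrArg (· * x) (mk_eq_of_rel K G (.vertex_mul_self u))
  · intro u' _ hu'
    exact mk_eq_of_rel K G (.vertex_mul_vertex u' u hu')
  · simp

theorem mul_sum_vertex_eq {x : LeavittPathAlgebra K G} (u : V) (h : x * vertex K G u = x) :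
    x * (∑ u', vertex K G u') = x := by
  rw [← h, mul_assoc, Finset.mul_sum, Finset.sum_eq_single u]
  · exact congrArg (x * ·) (mk_eq_of_rel K G (.vertex_mul_self u))
  · intro u' _ hu'
    exact mk_eq_of_rel K G (.vertex_mul_vertex u u' hu'.symm)
  · simp

theorem sum_vertex_mul_gen (g : Generator V E) :
    (∑ u, vertex K G u) * mk K G (FreeAlg.gen K g) = mk K G (FreeAlg.gen K g) := by
  cases g with
  | vertex u => exact sum_vertex_mul_eq K G u (mk_eq_of_rel K G (.vertex_mul_self u))
  | edge e => exact sum_vertex_mul_eq K G _ (mk_eq_of_rel K G (.source_mul_edge e))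
  | ghost e => exact sum_vertex_mul_eq K G _ (mk_eq_of_rel K G (.range_mul_ghost e))

theorem gen_mul_sum_vertex (g : Generator V E) :
    mk K G (FreeAlg.gen K g) * (∑ u, vertex K G u) = mk K G (FreeAlg.gen K g) := by
  cases g with
  | vertex u => exact mul_sum_vertex_eq K G u (mk_eq_of_rel K G (.vertex_mul_self u))
  | edge e => exact mul_sum_vertex_eq K G _ (mk_eq_of_rel K G (.edge_mul_range e))
  | ghost e => exact mul_sum_vertex_eq K G _ (mk_eq_of_rel K G (.ghost_mul_source e))

theorem sum_vertex_mul (x : LeavittPathAlgebra K G) : (∑ u, vertex K G u) * x = x := by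
  induction x using gen_induction with
  | gen g => exact sum_vertex_mul_gen K G g
  | mul x y hx _ => rw [← mul_assoc, hx]
  | add x y hx hy => rw [mul_add, hx, hy]
  | smul c x hx => rw [mul_smul_comm, hx]
  | zero => rw [mul_zero]

theorem mul_sum_vertex (x : LeavittPathAlgebra K G) : x * (∑ u, vertex K G u) = x := by
  induction x using gen_induction with
  | gen g => exact gen_mul_sum_vertex K G g
  | mul x y _ hy => rw [mul_assoc, hy]
  | add x y hx hy => rw [add_mul, hx, hy]
  | smul c x hx => rw [smul_mul_assoc, hx]
  | zero => rw [zero_mul]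

/-- The Leavitt path algebra of a graph with finitely many vertices is a unital ring, with identity
the sum of the vertices. -/
noncomputable instance instRing : Ring (LeavittPathAlgebra K G) :=
  { instNonUnitalRing K G with
    one := ∑ u, vertex K G u
    one_mul := sum_vertex_mul K G
    mul_one := mul_sum_vertex K G }

theorem one_def : (1 : LeavittPathAlgebra K G) = ∑ u, vertex K G u := rfl

noncomputable instance instAlgebra : Algebra K (LeavittPathAlgebra K G) :=
  Algebra.ofModule smul_mul_assoc mul_smul_comm

end Unital

/-- For edges `e₁, …, eₙ` and `n × n` matrices `P` and `Q`, the map `φ` has the values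
prescribed for `φ_{P, Q}` on the generators of the Leavitt path algebra. -/
structure IsMatrixTwist {n : ℕ} (e : Fin n → E)
    (P Q : Matrix (Fin n) (Fin n) (LeavittPathAlgebra K G))
    (φ : LeavittPathAlgebra K G → LeavittPathAlgebra K G) : Prop where
  map_vertex : ∀ u : V, φ (vertex K G u) = vertex K G u
  map_edge_of_notMem : ∀ f : E, f ∉ Set.range e → φ (edge K G f) = edge K G f
  map_ghost_of_notMem : ∀ f : E, f ∉ Set.range e → φ (ghost K G f) = ghost K G f
  map_edge : ∀ i, φ (edge K G (e i)) = ∑ k, edge K G (e k) * P k i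
  map_ghost : ∀ i, φ (ghost K G (e i)) = ∑ k, Q i k * ghost K G (e k)

end LeavittPathAlgebra

end DirectedGraph

/-! Existence in (i) is the universal property: the prescribed images satisfy the Leavitt relations,
`Q * P = 1` giving those for `e* f`, `P * Q = 1` the one at a regular vertex, and commutation with
`w` the ones on ranges. Uniqueness holds because the values on the generators are prescribed.

For (ii) write `φ` for `φ_P` and `ψ` for `φ_{P⁻¹}`. If `φ` fixes the entries of `P` it also fixes
those of `P⁻¹`, and a direct computation gives `φ ∘ ψ = id` (`comp_eq_id`). The same computation for
`ψ ∘ φ` would need `ψ` to fix the entries of `P`, which is not given. So only surjectivity of `φ` is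
immediate, and the substance is `injective_of_surjective`: a surjective endomorphism fixing the
vertices is injective.

Its proof reduces a nonzero element of the kernel, by multiplications on both sides, to `k u + z`
with `k ≠ 0` and `z` a combination of closed paths of positive length at the vertex `u`
(`exists_mul_mem_ghostFiltration_zero`, `exists_mul_mul_vertex_eq`). If paths from `u` branch,
compressing by a suitable path kills `z` and puts a multiple of a vertex in the kernel, which is
absurd. If they do not branch and `u` is on no closed path, then `z = 0`. Otherwise the closed paths
at `u` are the powers of one cycle `c`, and `k u + z = f(c)` with `f(0) ≠ 0`. Then `φ(c)` is
algebraic and invertible in the corner at `u`; surjectivity makes the whole corner a quotient of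
`K[X]/(f)`, hence finite-dimensional, although it contains a copy of `K[X]`
(`cornerEval_map_ne_zero`). Linear independence comes from a graded representation
(`exists_gradedFamily`). -/

namespace DirectedGraph

variable {V : Type u} {E : Type v}

/-! ### Universal property -/

/-- A family of elements of a `K`-algebra satisfying the defining relations of the Leavitt path
algebra of `G`. -/
structure LeavittFamily (G : DirectedGraph V E) (A : Type*) [NonUnitalRing A] where
  /-- the images of the vertices -/
  vertex : V → A
  /-- the images of the edges -/
  edge : E → A
  /-- the images of the ghost edges -/
  ghost : E → A
  vertex_mul_self : ∀ u, vertex u * vertex u = vertex u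
  vertex_mul_vertex : ∀ u u', u ≠ u' → vertex u * vertex u' = 0
  source_mul_edge : ∀ e, vertex (G.s e) * edge e = edge e
  edge_mul_range : ∀ e, edge e * vertex (G.r e) = edge e
  ghost_mul_source : ∀ e, ghost e * vertex (G.s e) = ghost e
  range_mul_ghost : ∀ e, vertex (G.r e) * ghost e = ghost e
  ghost_mul_self : ∀ e, ghost e * edge e = vertex (G.r e)
  ghost_mul_edge : ∀ e f, e ≠ f → ghost e * edge f = 0
  regular : ∀ u (hfin : {e : E | G.s e = u}.Finite), {e : E | G.s e = u}.Nonempty →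
    vertex u = ∑ e ∈ hfin.toFinset, edge e * ghost e

namespace LeavittFamily

variable {K : Type w} [Field K] {G : DirectedGraph V E} {A : Type*} [NonUnitalRing A] [Module K A]
  [IsScalarTower K A A] [SMulCommClass K A A] (F : LeavittFamily G A)

/-- The images of the generators under a Leavitt family. -/
def onGenerator : Generator V E → A
  | .vertex u => F.vertex u
  | .edge e => F.edge e
  | .ghost e => F.ghost e

variable (K) in
/-- The homomorphism from the free algebra given by a Leavitt family. -/
noncomputable def freeLift : FreeAlg K V E →ₙₐ[K] A :=
  MonoidAlgebra.liftMagma K (FreeSemigroup.lift F.onGenerator)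

theorem freeLift_gen (g : Generator V E) :
    F.freeLift K (FreeAlg.gen K g) = F.onGenerator g := by
  simp [freeLift, FreeAlg.gen, MonoidAlgebra.liftMagma]

theorem freeLift_eq_of_rel {a b : FreeAlg K V E} (h : LeavittRel K G a b) :
    F.freeLift K a = F.freeLift K b := by
  induction h with
  | vertex_mul_self u => simpa [freeLift_gen, onGenerator] using F.vertex_mul_self u
  | vertex_mul_vertex u u' h => simpa [freeLift_gen, onGenerator] using F.vertex_mul_vertex u u' h
  | source_mul_edge e => simpa [freeLift_gen, onGenerator] using F.source_mul_edge e
  | edge_mul_range e => simpa [freeLift_gen, onGenerator] using F.edge_mul_range e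
  | ghost_mul_source e => simpa [freeLift_gen, onGenerator] using F.ghost_mul_source e
  | range_mul_ghost e => simpa [freeLift_gen, onGenerator] using F.range_mul_ghost e
  | ghost_mul_self e => simpa [freeLift_gen, onGenerator] using F.ghost_mul_self e
  | ghost_mul_edge e f h => simpa [freeLift_gen, onGenerator] using F.ghost_mul_edge e f h
  | regular u hfin hne => simpa [freeLift_gen, onGenerator] using F.regular u hfin hne

theorem freeLift_eq_of_con {a b : FreeAlg K V E} (h : leavittCon K G a b) :
    F.freeLift K a = F.freeLift K b := by
  have h' : RingConGen.Rel _ a b := h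
  clear h
  induction h' with
  | of x y h =>
    obtain ⟨c, a, b, h, rfl, rfl⟩ := h
    rw [map_smul, map_smul, F.freeLift_eq_of_rel h]
  | refl x => rfl
  | symm _ ih => exact ih.symm
  | trans _ _ ih₁ ih₂ => exact ih₁.trans ih₂
  | add _ _ ih₁ ih₂ => rw [map_add, map_add, ih₁, ih₂]
  | mul _ _ ih₁ ih₂ => rw [map_mul, map_mul, ih₁, ih₂]

open LeavittPathAlgebra

variable (K) in
/-- The universal property of the Leavitt path algebra. -/
noncomputable def lift : LeavittPathAlgebra K G →ₙₐ[K] A where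
  toFun := Quotient.lift (F.freeLift K) fun _ _ h => F.freeLift_eq_of_con h
  map_smul' c x := by
    obtain ⟨x, rfl⟩ := mk_surjective K G x
    exact map_smul (F.freeLift K) c x
  map_zero' := map_zero (F.freeLift K)
  map_add' x y := by
    obtain ⟨x, rfl⟩ := mk_surjective K G x
    obtain ⟨y, rfl⟩ := mk_surjective K G y
    exact map_add (F.freeLift K) x y
  map_mul' x y := by
    obtain ⟨x, rfl⟩ := mk_surjective K G x
    obtain ⟨y, rfl⟩ := mk_surjective K G y
    exact map_mul (F.freeLift K) x y

theorem lift_vertex (u : V) : F.lift K (LeavittPathAlgebra.vertex K G u) = F.vertex u :=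
  F.freeLift_gen (.vertex u)

theorem lift_edge (e : E) : F.lift K (LeavittPathAlgebra.edge K G e) = F.edge e :=
  F.freeLift_gen (.edge e)

theorem lift_ghost (e : E) : F.lift K (LeavittPathAlgebra.ghost K G e) = F.ghost e :=
  F.freeLift_gen (.ghost e)

end LeavittFamily

/-! ### Matrix twists: existence, uniqueness and composition -/

namespace LeavittPathAlgebra

variable {K : Type w} [Field K] {G : DirectedGraph V E}

theorem hom_ext {A : Type*} [NonUnitalRing A] [Module K A] {φ ψ : LeavittPathAlgebra K G →ₙₐ[K] A}
    (hv : ∀ u, φ (vertex K G u) = ψ (vertex K G u)) (he : ∀ e, φ (edge K G e) = ψ (edge K G e))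
    (hg : ∀ e, φ (ghost K G e) = ψ (ghost K G e)) (x : LeavittPathAlgebra K G) : φ x = ψ x := by
  induction x using gen_induction with
  | gen g => cases g with
    | vertex u => exact hv u
    | edge e => exact he e
    | ghost e => exact hg e
  | mul x y hx hy => rw [map_mul, map_mul, hx, hy]
  | add x y hx hy => rw [map_add, map_add, hx, hy]
  | smul c x hx => rw [map_smul, map_smul, hx]
  | zero => rw [map_zero, map_zero]

section Relations

theorem vertex_mul_self (u : V) : vertex K G u * vertex K G u = vertex K G u :=
  mk_eq_of_rel K G (.vertex_mul_self u)

theorem vertex_mul_vertex {u u' : V} (h : u ≠ u') : vertex K G u * vertex K G u' = 0 :=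
  mk_eq_of_rel K G (.vertex_mul_vertex u u' h)

theorem source_mul_edge (e : E) : vertex K G (G.s e) * edge K G e = edge K G e :=
  mk_eq_of_rel K G (.source_mul_edge e)

theorem edge_mul_range (e : E) : edge K G e * vertex K G (G.r e) = edge K G e :=
  mk_eq_of_rel K G (.edge_mul_range e)

theorem ghost_mul_source (e : E) : ghost K G e * vertex K G (G.s e) = ghost K G e :=
  mk_eq_of_rel K G (.ghost_mul_source e)

theorem range_mul_ghost (e : E) : vertex K G (G.r e) * ghost K G e = ghost K G e :=
  mk_eq_of_rel K G (.range_mul_ghost e)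

theorem ghost_mul_self (e : E) : ghost K G e * edge K G e = vertex K G (G.r e) :=
  mk_eq_of_rel K G (.ghost_mul_self e)

theorem ghost_mul_edge {e f : E} (h : e ≠ f) : ghost K G e * edge K G f = 0 :=
  mk_eq_of_rel K G (.ghost_mul_edge e f h)

theorem vertex_eq_sum (u : V) (hfin : {e : E | G.s e = u}.Finite)
    (hne : {e : E | G.s e = u}.Nonempty) :
    vertex K G u = ∑ e ∈ hfin.toFinset, edge K G e * ghost K G e := by
  have h : ∀ (S : Finset E) (f : E → FreeAlg K V E),
      mk K G (∑ e ∈ S, f e) = ∑ e ∈ S, mk K G (f e) := fun S f =>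
    map_sum (⟨⟨mk K G, mk_zero K G⟩, mk_add K G⟩ : FreeAlg K V E →+ LeavittPathAlgebra K G) f S
  exact (mk_eq_of_rel K G (.regular u hfin hne)).trans (h _ _)

theorem vertex_mul_edge {u : V} {e : E} (h : G.s e ≠ u) : vertex K G u * edge K G e = 0 := by
  rw [← source_mul_edge, ← mul_assoc, vertex_mul_vertex h.symm, zero_mul]

theorem ghost_mul_vertex {u : V} {e : E} (h : G.s e ≠ u) : ghost K G e * vertex K G u = 0 := by
  rw [← ghost_mul_source, mul_assoc, vertex_mul_vertex h, mul_zero]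

end Relations

section Twist

variable [Fintype V] {n : ℕ} {v w : V} {e : Fin n → E}

open Classical in
/-- The family of elements of the Leavitt path algebra to which a matrix twist sends the
generators. -/
noncomputable def twistFamily (he : Function.Injective e)
    (hs : ∀ i, G.s (e i) = v) (hr : ∀ i, G.r (e i) = w)
    (P Q : Matrix (Fin n) (Fin n) (LeavittPathAlgebra K G)) (hPQ : P * Q = 1) (hQP : Q * P = 1)
    (hP : ∀ i j, vertex K G w * P i j = P i j * vertex K G w)
    (hQ : ∀ i j, vertex K G w * Q i j = Q i j * vertex K G w) :
    LeavittFamily G (LeavittPathAlgebra K G) where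
  vertex := vertex K G
  -- `h.choose` is the index `i` with `e i = f`; it is unique because `e` is injective.
  edge f := if h : f ∈ Set.range e then ∑ k, edge K G (e k) * P k h.choose else edge K G f
  ghost f := if h : f ∈ Set.range e then ∑ k, Q h.choose k * ghost K G (e k) else ghost K G f
  vertex_mul_self := vertex_mul_self
  vertex_mul_vertex _ _ h := vertex_mul_vertex h
  source_mul_edge f := by
    split_ifs with h
    · obtain ⟨i, rfl⟩ := id h
      rw [Finset.mul_sum]
      refine Finset.sum_congr rfl fun k _ => ?_
      rw [hs i, ← hs k, ← mul_assoc, source_mul_edge]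
    · exact source_mul_edge f
  edge_mul_range f := by
    split_ifs with h
    · obtain ⟨i, rfl⟩ := id h
      rw [Finset.sum_mul]
      refine Finset.sum_congr rfl fun k _ => ?_
      rw [hr i, mul_assoc, ← hP, ← hr k, ← mul_assoc, edge_mul_range]
    · exact edge_mul_range f
  ghost_mul_source f := by
    split_ifs with h
    · obtain ⟨i, rfl⟩ := id h
      rw [Finset.sum_mul]
      refine Finset.sum_congr rfl fun k _ => ?_
      rw [hs i, ← hs k, mul_assoc, ghost_mul_source]
    · exact ghost_mul_source f
  range_mul_ghost f := by
    split_ifs with h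
    · obtain ⟨i, rfl⟩ := id h
      rw [Finset.mul_sum]
      refine Finset.sum_congr rfl fun k _ => ?_
      rw [hr i, ← mul_assoc, hQ, ← hr k, mul_assoc, range_mul_ghost]
    · exact range_mul_ghost f
  ghost_mul_self f := by
    split_ifs with h
    · have hj := h.choose_spec
      generalize h.choose = j at hj
      subst hj
      -- Only `l = k` survives, since `e_k* e_l` is `w` or `0`; the `w` in the middle then moves
      -- left past `Q j k`.
      have : ∀ k, (Q j k * ghost K G (e k)) * ∑ l, edge K G (e l) * P l j
          = vertex K G w * (Q j k * P k j) := by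
        intro k
        rw [Finset.mul_sum, Finset.sum_eq_single k]
        · rw [mul_assoc, ← mul_assoc (ghost K G _), ghost_mul_self, hr, ← mul_assoc, ← hQ,
            mul_assoc]
        · intro l _ hl
          rw [mul_assoc, ← mul_assoc (ghost K G _), ghost_mul_edge (fun h => hl (he h).symm),
            zero_mul, mul_zero]
        · simp
      rw [Finset.sum_mul, Finset.sum_congr rfl fun k _ => this k, ← Finset.mul_sum,
        ← Matrix.mul_apply, hQP, Matrix.one_apply_eq, mul_one, hr]
    · exact ghost_mul_self f
  ghost_mul_edge f f' hff' := by
    split_ifs with h h' h'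
    · have hj := h.choose_spec
      generalize h.choose = j at hj
      have hj' := h'.choose_spec
      generalize h'.choose = j' at hj'
      subst hj hj'
      have : ∀ k, (Q j k * ghost K G (e k)) * ∑ l, edge K G (e l) * P l j'
          = vertex K G w * (Q j k * P k j') := by
        intro k
        rw [Finset.mul_sum, Finset.sum_eq_single k]
        · rw [mul_assoc, ← mul_assoc (ghost K G _), ghost_mul_self, hr, ← mul_assoc, ← hQ,
            mul_assoc]
        · intro l _ hl
          rw [mul_assoc, ← mul_assoc (ghost K G _), ghost_mul_edge (fun h => hl (he h).symm),
            zero_mul, mul_zero]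
        · simp
      rw [Finset.sum_mul, Finset.sum_congr rfl fun k _ => this k, ← Finset.mul_sum,
        ← Matrix.mul_apply, hQP, Matrix.one_apply_ne (fun h => hff' (congrArg e h)), mul_zero]
    · rw [Finset.sum_mul]
      refine Finset.sum_eq_zero fun k _ => ?_
      rw [mul_assoc, ghost_mul_edge (fun h => h' ⟨k, h⟩), mul_zero]
    · rw [Finset.mul_sum]
      refine Finset.sum_eq_zero fun k _ => ?_
      rw [← mul_assoc, ghost_mul_edge (fun h'' => h ⟨k, h''.symm⟩), zero_mul]
    · exact ghost_mul_edge hff'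
  regular u hfin hne := by
    rw [vertex_eq_sum u hfin hne]
    -- In the remaining case no `e i` starts at `u`, so the relation at `u` is unchanged.
    by_cases hu : u = v ∧ 0 < n
    · obtain ⟨rfl, hn⟩ := hu
      have hsub : Finset.univ.map ⟨e, he⟩ ⊆ hfin.toFinset := by
        intro f
        simp only [Finset.mem_map, Set.Finite.mem_toFinset]
        rintro ⟨i, -, rfl⟩
        exact hs i
      -- Edges outside the family contribute the same terms on both sides; those of the family give
      -- `∑ e_k (PQ)_{kl} e_l*`, where `P * Q = 1`.
      rw [← Finset.sum_sdiff hsub, ← Finset.sum_sdiff hsub]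
      congr 1
      · refine Finset.sum_congr rfl fun f hf => ?_
        have : f ∉ Set.range e := fun ⟨i, hi⟩ => (Finset.mem_sdiff.1 hf).2
          (Finset.mem_map.2 ⟨i, Finset.mem_univ i, hi⟩)
        rw [dif_neg this, dif_neg this]
      · have hc : ∀ i (h : e i ∈ Set.range e), h.choose = i := fun i h => he h.choose_spec
        simp only [Finset.sum_map, Function.Embedding.coeFn_mk, Set.mem_range_self, dite_true, hc]
        have : ∀ i, (∑ k, edge K G (e k) * P k i) * ∑ l, Q i l * ghost K G (e l) =
            ∑ k, ∑ l, edge K G (e k) * (P k i * Q i l) * ghost K G (e l) := by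
          intro i
          rw [Finset.sum_mul_sum]
          simp only [mul_assoc]
        rw [Finset.sum_congr rfl fun i _ => this i, Finset.sum_comm]
        refine Finset.sum_congr rfl fun k _ => ?_
        rw [Finset.sum_comm]
        simp only [← Finset.sum_mul, ← Finset.mul_sum, ← Matrix.mul_apply, hPQ]
        rw [Finset.sum_eq_single k]
        · rw [Matrix.one_apply_eq, mul_one]
        · intro l _ hl
          rw [Matrix.one_apply_ne hl.symm, mul_zero, zero_mul]
        · simp
    · refine Finset.sum_congr rfl fun f hf => ?_
      have : f ∉ Set.range e := by
        rintro ⟨i, rfl⟩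
        exact hu ⟨((hfin.mem_toFinset.1 hf).symm.trans (hs i)), i.pos⟩
      rw [dif_neg this, dif_neg this]

/-- A non-unital homomorphism between Leavitt path algebras that preserves the vertices is
unital. -/
noncomputable def algHomOfMapVertex (φ : LeavittPathAlgebra K G →ₙₐ[K] LeavittPathAlgebra K G)
    (h : ∀ u, φ (vertex K G u) = vertex K G u) :
    LeavittPathAlgebra K G →ₐ[K] LeavittPathAlgebra K G :=
  AlgHom.ofLinearMap (φ : LeavittPathAlgebra K G →ₗ[K] LeavittPathAlgebra K G)
    (by
      change φ 1 = 1
      rw [one_def, map_sum]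
      exact Finset.sum_congr rfl fun u _ => h u)
    (map_mul φ)

theorem exists_isMatrixTwist (he : Function.Injective e)
    (hs : ∀ i, G.s (e i) = v) (hr : ∀ i, G.r (e i) = w)
    (P Q : Matrix (Fin n) (Fin n) (LeavittPathAlgebra K G)) (hPQ : P * Q = 1) (hQP : Q * P = 1)
    (hP : ∀ i j, vertex K G w * P i j = P i j * vertex K G w)
    (hQ : ∀ i j, vertex K G w * Q i j = Q i j * vertex K G w) :
    ∃ φ : LeavittPathAlgebra K G →ₐ[K] LeavittPathAlgebra K G, IsMatrixTwist K G e P Q φ := by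
  classical
  let F := twistFamily he hs hr P Q hPQ hQP hP hQ
  have hc : ∀ i (h : e i ∈ Set.range e), h.choose = i := fun i h => he h.choose_spec
  refine ⟨algHomOfMapVertex (F.lift K) F.lift_vertex, F.lift_vertex, fun f hf => ?_, fun f hf => ?_,
    fun i => ?_, fun i => ?_⟩
  · exact (F.lift_edge f).trans (dif_neg hf)
  · exact (F.lift_ghost f).trans (dif_neg hf)
  · refine (F.lift_edge (e i)).trans ((dif_pos ⟨i, rfl⟩).trans ?_)
    exact Finset.sum_congr rfl fun k _ => congrArg (fun j => edge K G (e k) * P k j) (hc i _)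
  · refine (F.lift_ghost (e i)).trans ((dif_pos ⟨i, rfl⟩).trans ?_)
    exact Finset.sum_congr rfl fun k _ => congrArg (fun j => Q j k * ghost K G (e k)) (hc i _)

theorem IsMatrixTwist.ext {P Q : Matrix (Fin n) (Fin n) (LeavittPathAlgebra K G)}
    {φ ψ : LeavittPathAlgebra K G →ₙₐ[K] LeavittPathAlgebra K G}
    (hφ : IsMatrixTwist K G e P Q φ) (hψ : IsMatrixTwist K G e P Q ψ)
    (x : LeavittPathAlgebra K G) : φ x = ψ x := by
  refine hom_ext (fun u => ?_) (fun f => ?_) (fun f => ?_) x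
  · rw [hφ.map_vertex, hψ.map_vertex]
  · by_cases hf : f ∈ Set.range e
    · obtain ⟨i, rfl⟩ := hf
      rw [hφ.map_edge, hψ.map_edge]
    · rw [hφ.map_edge_of_notMem f hf, hψ.map_edge_of_notMem f hf]
  · by_cases hf : f ∈ Set.range e
    · obtain ⟨i, rfl⟩ := hf
      rw [hφ.map_ghost, hψ.map_ghost]
    · rw [hφ.map_ghost_of_notMem f hf, hψ.map_ghost_of_notMem f hf]

/-- Both `φ(Q)` and `P⁻¹ = Q` are inverses of `P = φ(P)`, so `φ` fixes `Q` too. Then `φ(ψ(e_i)) = ∑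
φ(e_k) q_{ki} = ∑ e_l (PQ)_{li} = e_i`, and similarly for ghosts. Nothing is assumed about `ψ` on
the entries of `P`. -/
theorem IsMatrixTwist.comp_eq_id {P Q : Matrix (Fin n) (Fin n) (LeavittPathAlgebra K G)}
    (hPQ : P * Q = 1) (hQP : Q * P = 1)
    {φ ψ : LeavittPathAlgebra K G →ₐ[K] LeavittPathAlgebra K G}
    (hφ : IsMatrixTwist K G e P Q φ) (hψ : IsMatrixTwist K G e Q P ψ)
    (hP : ∀ i j, φ (P i j) = P i j) (x : LeavittPathAlgebra K G) : φ (ψ x) = x := by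
  have hPm : φ.mapMatrix P = P := Matrix.ext hP
  have hQm : φ.mapMatrix Q = Q := by
    have h : φ.mapMatrix Q * P = 1 := by
      conv_lhs => rw [← hPm]
      rw [← map_mul, hQP, map_one]
    exact left_inv_eq_right_inv h hPQ
  have hQ : ∀ i j, φ (Q i j) = Q i j := fun i j => congrFun (congrFun hQm i) j
  refine hom_ext (φ := ((φ.comp ψ : _ →ₐ[K] _) : _ →ₙₐ[K] _)) (ψ := NonUnitalAlgHom.id K _)
    (fun u => ?_) (fun f => ?_) (fun f => ?_) x
  · change φ (ψ _) = vertex K G u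
    rw [hψ.map_vertex, hφ.map_vertex]
  · change φ (ψ _) = edge K G f
    by_cases hf : f ∈ Set.range e
    · obtain ⟨i, rfl⟩ := hf
      simp only [hψ.map_edge, map_sum, map_mul, hφ.map_edge, hQ, Finset.sum_mul, mul_assoc]
      rw [Finset.sum_comm]
      simp only [← Finset.mul_sum, ← Matrix.mul_apply, hPQ]
      rw [Finset.sum_eq_single i]
      · rw [Matrix.one_apply_eq, mul_one]
      · intro l _ hl
        rw [Matrix.one_apply_ne hl, mul_zero]
      · simp
    · rw [hψ.map_edge_of_notMem f hf, hφ.map_edge_of_notMem f hf]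
  · change φ (ψ _) = ghost K G f
    by_cases hf : f ∈ Set.range e
    · obtain ⟨i, rfl⟩ := hf
      simp only [hψ.map_ghost, map_sum, map_mul, hφ.map_ghost, hP, Finset.mul_sum, ← mul_assoc]
      rw [Finset.sum_comm]
      simp only [← Finset.sum_mul, ← Matrix.mul_apply, hPQ]
      rw [Finset.sum_eq_single i]
      · rw [Matrix.one_apply_eq, one_mul]
      · intro l _ hl
        rw [Matrix.one_apply_ne hl.symm, zero_mul]
      · simp
    · rw [hψ.map_ghost_of_notMem f hf, hφ.map_ghost_of_notMem f hf]

end Twist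

end LeavittPathAlgebra

end DirectedGraph

/-! ### A graded representation -/

namespace DirectedGraph

variable {V : Type u} {E : Type v}

section Representation

open Cardinal in
/-- An infinite set on which the edges act by injections which, for every vertex that is not a
sink, give a partition into the images of the edges starting there. -/
theorem exists_push (G : DirectedGraph V E) : ∃ push : E → E ⊕ ℕ → E ⊕ ℕ,
    (∀ e f x y, G.s e = G.s f → push e x = push f y → e = f ∧ x = y) ∧
    ∀ e x, ∃ f y, G.s f = G.s e ∧ push f y = x := by
  -- `E ⊕ ℕ` is infinite and at least as large as `E`, so it absorbs a product with any nonempty set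
  -- of edges.
  have key : ∀ u, Nonempty {e // G.s e = u} →
      Nonempty (({e // G.s e = u} × (E ⊕ ℕ)) ≃ (E ⊕ ℕ)) := by
    intro u hu
    rw [← Cardinal.eq, Cardinal.mk_prod, Cardinal.lift_id, Cardinal.lift_id]
    refine Cardinal.mul_eq_right (Cardinal.aleph0_le_mk _) ?_ (Cardinal.mk_ne_zero _)
    exact Cardinal.mk_le_of_injective (f := fun e => Sum.inl e.1)
      fun a b h => Subtype.ext (Sum.inl_injective h)
  let θ : ∀ e, ({f // G.s f = G.s e} × (E ⊕ ℕ)) ≃ (E ⊕ ℕ) := fun e =>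
    (key (G.s e) ⟨⟨e, rfl⟩⟩).some
  -- The bijection `θ e` depends only on the source of `e`; this is what makes the images of edges
  -- with a common source disjoint and jointly exhaustive.
  have hθ : ∀ e f (h : G.s e = G.s f) x, θ e (⟨e, rfl⟩, x) = θ f (⟨e, h⟩, x) := by
    intro e f h x
    have : ∀ u (h : G.s e = u) (h' : Nonempty {e // G.s e = u}),
        θ e (⟨e, rfl⟩, x) = (key u h').some (⟨e, h⟩, x) := by
      rintro u rfl h'
      rfl
    exact this _ h ⟨⟨f, rfl⟩⟩
  refine ⟨fun e x => θ e (⟨e, rfl⟩, x), fun e f x y h hxy => ?_, fun e x => ?_⟩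
  · have := (θ f).injective ((hθ e f h x).symm.trans hxy)
    rw [Prod.mk.injEq, Subtype.mk.injEq] at this
    exact this
  · obtain ⟨⟨⟨f, hf⟩, y⟩, rfl⟩ := (θ e).surjective x
    exact ⟨f, y, hf, hθ f e hf y⟩

variable (K : Type w) [Field K]

/-- The linear endomorphism of the space with basis `B` given by a partial map of `B` to itself. -/
noncomputable def partialEnd {B : Type*} (f : B → Option B) : Module.End K (B →₀ K) :=
  Finsupp.linearCombination K fun b => (f b).elim 0 fun b' => Finsupp.single b' 1

theorem partialEnd_single {B : Type*} (f : B → Option B) (b : B) :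
    partialEnd K f (Finsupp.single b 1) = (f b).elim 0 fun b' => Finsupp.single b' 1 := by
  simp [partialEnd]

theorem partialEnd_mul {B : Type*} (f g : B → Option B) :
    partialEnd K f * partialEnd K g = partialEnd K fun b => (g b).bind f := by
  refine Finsupp.lhom_ext' fun b => LinearMap.ext_ring ?_
  simp only [LinearMap.comp_apply, Finsupp.lsingle_apply, Module.End.mul_apply, partialEnd_single]
  cases g b with
  | none => simp
  | some b' => simp [partialEnd_single]

theorem partialEnd_none {B : Type*} : partialEnd K (fun _ : B => none) = 0 := by
  refine Finsupp.lhom_ext' fun b => LinearMap.ext_ring ?_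
  simp [partialEnd_single]

/-- A graded representation of the Leavitt path algebra in which no vertex acts as zero. -/
theorem exists_gradedFamily (G : DirectedGraph V E) :
    ∃ (x₀ : E ⊕ ℕ) (F : LeavittFamily G (Module.End K ((V × (E ⊕ ℕ) × ℤ) →₀ K))),
      (∀ u, F.vertex u (Finsupp.single (u, x₀, 0) 1) = Finsupp.single (u, x₀, 0) 1) ∧
      (∀ u b, F.vertex u (Finsupp.single b 1) ∈ Finsupp.supported K K {b' | b'.2.2 = b.2.2}) ∧
      ∀ e b, F.edge e (Finsupp.single b 1) ∈ Finsupp.supported K K {b' | b'.2.2 = b.2.2 + 1} := by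
  classical
  obtain ⟨push, hinj, hsurj⟩ := G.exists_push
  have hch : ∀ e x (h : ∃ y, push e y = push e x), h.choose = x := fun e x h =>
    (hinj e e _ _ rfl h.choose_spec).2
  -- On basis vectors `(u, x, j)`: a vertex projects onto its own copy of `E ⊕ ℕ`, an edge maps the
  -- copy at its range into the copy at its source by `push` and raises the degree `j` by one, and a
  -- ghost is the partial inverse.
  let fv : V → V × (E ⊕ ℕ) × ℤ → Option (V × (E ⊕ ℕ) × ℤ) := fun u b =>
    if b.1 = u then some b else none
  let fe : E → V × (E ⊕ ℕ) × ℤ → Option (V × (E ⊕ ℕ) × ℤ) := fun e b =>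
    if b.1 = G.r e then some (G.s e, push e b.2.1, b.2.2 + 1) else none
  let fg : E → V × (E ⊕ ℕ) × ℤ → Option (V × (E ⊕ ℕ) × ℤ) := fun e b =>
    if h : b.1 = G.s e ∧ ∃ y, push e y = b.2.1 then some (G.r e, h.2.choose, b.2.2 - 1) else none
  have hfg : ∀ e y j, fg e (G.s e, push e y, j) = some (G.r e, y, j - 1) := by
    intro e y j
    have h : G.s e = G.s e ∧ ∃ y', push e y' = push e y := ⟨rfl, y, rfl⟩
    refine (dif_pos h).trans ?_
    exact congrArg (fun z => some (G.r e, z, j - 1)) (hch e y h.2)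
  have hfg' : ∀ e b, ¬ (b.1 = G.s e ∧ ∃ y, push e y = b.2.1) → fg e b = none :=
    fun e b h => dif_neg h
  refine ⟨Sum.inr 0,
    { vertex := fun u => partialEnd K (fv u)
      edge := fun e => partialEnd K (fe e)
      ghost := fun e => partialEnd K (fg e)
      vertex_mul_self := fun u => ?_
      vertex_mul_vertex := fun u u' h => ?_
      source_mul_edge := fun e => ?_
      edge_mul_range := fun e => ?_
      ghost_mul_source := fun e => ?_
      range_mul_ghost := fun e => ?_
      ghost_mul_self := fun e => ?_
      ghost_mul_edge := fun e f h => ?_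
      regular := fun u hfin hne => ?_ }, fun u => ?_, fun u b => ?_, fun e b => ?_⟩
  · rw [partialEnd_mul]
    congr 1; funext b
    by_cases hb : b.1 = u <;> simp [fv, hb]
  · rw [partialEnd_mul, ← partialEnd_none]
    congr 1; funext b
    by_cases hb : b.1 = u' <;> simp [fv, hb, h.symm]
  · rw [partialEnd_mul]
    congr 1; funext b
    by_cases hb : b.1 = G.r e <;> simp [fv, fe, hb]
  · rw [partialEnd_mul]
    congr 1; funext b
    by_cases hb : b.1 = G.r e <;> simp [fv, fe, hb]
  · rw [partialEnd_mul]
    congr 1; funext b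
    by_cases hb : b.1 = G.s e <;> simp [fv, fg, hb]
  · rw [partialEnd_mul]
    congr 1; funext b
    by_cases hb : b.1 = G.s e ∧ ∃ y, push e y = b.2.1
    · obtain ⟨x, y, j⟩ := b
      obtain ⟨rfl, y, rfl⟩ := hb
      simp [hfg, fv]
    · simp [hfg' e b hb]
  · rw [partialEnd_mul]
    congr 1; funext b
    by_cases hb : b.1 = G.r e
    · obtain ⟨x, y, j⟩ := b
      obtain rfl : x = G.r e := hb
      simp [fe, fv, hfg]
    · simp [fe, fv, hb]
  · rw [partialEnd_mul, ← partialEnd_none]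
    congr 1; funext b
    by_cases hb : b.1 = G.r f
    · simp only [fe, hb, if_true, Option.bind_some]
      refine hfg' _ _ ?_
      rintro ⟨hs, y, hy⟩
      exact h (hinj e f _ _ hs.symm hy).1
    · simp [fe, hb]
  · refine Finsupp.lhom_ext' fun b => LinearMap.ext_ring ?_
    simp only [partialEnd_mul, LinearMap.comp_apply, Finsupp.lsingle_apply, LinearMap.sum_apply,
      partialEnd_single]
    by_cases hb : b.1 = u
    · obtain ⟨x, z, j⟩ := b
      obtain rfl : x = u := hb
      obtain ⟨e, rfl⟩ := hne
      -- Exactly one edge `f` starting at this vertex has `z` in its image, so the sum reduces to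
      -- one term.
      obtain ⟨f, y, hf, rfl⟩ := hsurj e z
      rw [Finset.sum_eq_single f]
      · rw [← hf, hfg]
        simp [fv, fe]
      · intro e' he' hne'
        rw [hfg']
        · rfl
        · rintro ⟨h1, y', hy'⟩
          exact hne' (hinj e' f _ _ (h1.symm.trans hf.symm) hy').1
      · intro h
        exact absurd (hfin.mem_toFinset.2 hf) h
    · rw [Finset.sum_eq_zero]
      · simp [fv, hb]
      · intro e he
        rw [hfg']
        · rfl
        · rintro ⟨h1, -⟩
          exact hb (h1.trans (hfin.mem_toFinset.1 he))
  · simp [partialEnd_single, fv]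
  · by_cases hb : b.1 = u
    · simpa [partialEnd_single, fv, hb] using Finsupp.single_mem_supported K 1 (by simp)
    · simp [partialEnd_single, fv, hb]
  · by_cases hb : b.1 = G.r e
    · simpa [partialEnd_single, fe, hb] using Finsupp.single_mem_supported K 1 (by simp)
    · simp [partialEnd_single, fe, hb]

end Representation

end DirectedGraph

/-! ### Paths, prefixes and branching -/

namespace DirectedGraph

variable {V : Type u} {E : Type v}

/-- The list of edges `l` is a path from the first vertex to the second. -/
def IsPath (G : DirectedGraph V E) : V → List E → V → Prop
  | u, [], x => u = x
  | u, e :: l, x => G.s e = u ∧ G.IsPath (G.r e) l x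

theorem isPath_append {G : DirectedGraph V E} {u x : V} {l m : List E} :
    G.IsPath u (l ++ m) x ↔ ∃ y, G.IsPath u l y ∧ G.IsPath y m x := by
  induction l generalizing u with
  | nil => simp [IsPath]
  | cons e l ih => simp [IsPath, ih, and_assoc]

theorem IsPath.target_unique {G : DirectedGraph V E} {u x y : V} {l : List E}
    (h : G.IsPath u l x) (h' : G.IsPath u l y) : x = y := by
  induction l generalizing u with
  | nil => exact h.symm.trans h'
  | cons e l ih => exact ih h.2 h'.2

theorem IsPath.flatten_replicate {G : DirectedGraph V E} {u : V} {c : List E}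
    (h : G.IsPath u c u) (N : ℕ) : G.IsPath u (List.replicate N c).flatten u := by
  induction N with
  | zero => rfl
  | succ N ih => exact isPath_append.2 ⟨u, h, ih⟩

section Lists

theorem flatten_replicate_add {α : Type*} (c : List α) (i j : ℕ) :
    (List.replicate (i + j) c).flatten =
      (List.replicate i c).flatten ++ (List.replicate j c).flatten := by
  rw [← List.replicate_append_replicate, List.flatten_append]

theorem flatten_replicate_mul {α : Type*} (c : List α) (i j : ℕ) :
    (List.replicate j (List.replicate i c).flatten).flatten =
      (List.replicate (i * j) c).flatten := by
  induction j with
  | zero => rfl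
  | succ j ih => rw [List.replicate_succ, List.flatten_cons, ih, ← flatten_replicate_add,
      Nat.mul_succ, Nat.add_comm]

theorem flatten_replicate_prefix {α : Type*} (c : List α) {i j : ℕ} (h : i ≤ j) :
    (List.replicate i c).flatten <+: (List.replicate j c).flatten := by
  obtain ⟨k, rfl⟩ := Nat.exists_eq_add_of_le h
  rw [flatten_replicate_add]
  exact List.prefix_append _ _

/-- Iterating the hypothesis makes `d` a prefix of `c ^ N * d` for every `N`; for `N = d.length` the
power of `c` is already at least as long as `d`. -/
theorem exists_prefix_flatten_replicate {α : Type*} {c d : List α} (hc : c ≠ [])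
    (h : d <+: c ++ d) : ∃ N, d <+: (List.replicate N c).flatten := by
  have key : ∀ N, d <+: (List.replicate N c).flatten ++ d := by
    intro N
    induction N with
    | zero => exact List.prefix_rfl
    | succ N ih =>
      refine h.trans ?_
      rw [List.replicate_succ, List.flatten_cons, List.append_assoc]
      exact (List.prefix_append_right_inj c).2 ih
  refine ⟨d.length, List.prefix_of_prefix_length_le (key d.length) (List.prefix_append _ _) ?_⟩
  have := List.length_pos_iff.2 hc
  simp only [List.length_flatten, List.map_replicate, List.sum_replicate, smul_eq_mul]
  exact Nat.le_mul_of_pos_right _ this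

/-- If `d` is not a prefix of a power of `c`, then the words `c ^ j * d` are pairwise
incomparable, so only finitely many of them are prefixes of powers of given words. -/
theorem exists_forall_not_prefix {α : Type*} (S : Finset (List α)) (hS : ∀ l ∈ S, l ≠ [])
    {c d : List α} (hc : c ≠ []) (hd : ∀ N, ¬ d <+: (List.replicate N c).flatten) :
    ∃ j, ∀ l ∈ S, ¬ (List.replicate j c).flatten ++ d <+:
      l ++ ((List.replicate j c).flatten ++ d) := by
  by_contra! H
  choose g hgS hg using H
  -- Pigeonhole on the finite set `S`: `c ^ i * d` and `c ^ j * d` are then prefixes of powers of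
  -- the same word, so the shorter is a prefix of the longer.
  obtain ⟨i, j, hij, hgij⟩ : ∃ i j, i < j ∧ g i = g j := by
    obtain ⟨i, j, hij, h⟩ := Finite.exists_ne_map_eq_of_infinite (fun j => (⟨g j, hgS j⟩ : S))
    have h' : g i = g j := congrArg Subtype.val h
    rcases lt_or_gt_of_ne hij with h1 | h1
    · exact ⟨i, j, h1, h'⟩
    · exact ⟨j, i, h1, h'.symm⟩
  obtain ⟨N, hN⟩ := exists_prefix_flatten_replicate (hS _ (hgS i)) (hg i)
  obtain ⟨M, hM⟩ := exists_prefix_flatten_replicate (hS _ (hgS j)) (hg j)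
  rw [← hgij] at hM
  have hN' := hN.trans (flatten_replicate_prefix (g i) (le_max_left N M))
  have hM' := hM.trans (flatten_replicate_prefix (g i) (le_max_right N M))
  obtain ⟨k, rfl⟩ := Nat.exists_eq_add_of_lt hij
  have hlen := List.length_pos_iff.2 hc
  have h1 := List.prefix_of_prefix_length_le hN' hM' (by
    simp only [List.length_append, List.length_flatten, List.map_replicate, List.sum_replicate,
      smul_eq_mul]
    gcongr)
  -- Cancelling `c ^ i` leaves `d` as a prefix of `c ^ (k + 1) * d`, hence of a power of `c`.
  rw [add_assoc, flatten_replicate_add, List.append_assoc, List.prefix_append_right_inj] at h1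
  have hck : (List.replicate (k + 1) c).flatten ≠ [] := by
    rw [List.replicate_succ, List.flatten_cons]
    exact fun h => hc (List.append_eq_nil_iff.1 h).1
  obtain ⟨M, hM⟩ := exists_prefix_flatten_replicate hck h1
  rw [flatten_replicate_mul] at hM
  exact hd _ hM

end Lists

/-- The paths that start at `u` do not branch. -/
def NonBranching (G : DirectedGraph V E) (u : V) : Prop :=
  ∀ l m x y, G.IsPath u l x → G.IsPath u m y → l <+: m ∨ m <+: l

/-- Take `c` to be a shortest nonempty closed path. Without branching it is a prefix of every
nonempty closed path at `u`; strip it off and induct on the length. -/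
theorem NonBranching.exists_cycle {G : DirectedGraph V E} {u : V} (h : G.NonBranching u)
    {l : List E} (hl : l ≠ []) (hlu : G.IsPath u l u) :
    ∃ c, c ≠ [] ∧ G.IsPath u c u ∧
      ∀ m, G.IsPath u m u → ∃ N, m = (List.replicate N c).flatten := by
  classical
  have hex : ∃ k, ∃ c : List E, c.length = k ∧ c ≠ [] ∧ G.IsPath u c u := ⟨_, l, rfl, hl, hlu⟩
  obtain ⟨c, hck, hc, hcu⟩ := Nat.find_spec hex
  refine ⟨c, hc, hcu, fun m => ?_⟩
  induction hk : m.length using Nat.strong_induction_on generalizing m with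
  | _ k ih =>
    intro hm
    by_cases hm0 : m = []
    · exact ⟨0, hm0⟩
    have hle : c.length ≤ m.length := hck ▸ Nat.find_min' hex ⟨m, rfl, hm0, hm⟩
    have hpre : c <+: m := by
      rcases h c m u u hcu hm with h | h
      · exact h
      · rw [h.eq_of_length_le hle]
    obtain ⟨m', rfl⟩ := hpre
    obtain ⟨y, hy, hm'⟩ := isPath_append.1 hm
    obtain rfl := hcu.target_unique hy
    have := List.length_pos_iff.2 hc
    obtain ⟨N, rfl⟩ := ih m'.length (by rw [← hk, List.length_append]; omega) m' rfl hm'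
    exact ⟨N + 1, rfl⟩

/-- At a vertex where paths branch, some path is not a prefix of the powers of given closed
paths. -/
theorem exists_isPath_forall_not_prefix {G : DirectedGraph V E} {u : V} (h : ¬ G.NonBranching u)
    (S : Finset (List E)) (hS : ∀ l ∈ S, l ≠ [] ∧ G.IsPath u l u) :
    ∃ d x, G.IsPath u d x ∧ ∀ l ∈ S, ¬ d <+: l ++ d := by
  rcases S.eq_empty_or_nonempty with rfl | ⟨c, hcS⟩
  · exact ⟨[], u, rfl, by simp⟩
  obtain ⟨hc, hcu⟩ := hS c hcS
  obtain ⟨d, x, hd, hdc⟩ :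
      ∃ d x, G.IsPath u d x ∧ ∀ N, ¬ d <+: (List.replicate N c).flatten := by
    -- If every path from `u` were a prefix of a power of `c`, any two would be comparable,
    -- contradicting branching.
    by_contra! H
    refine h fun l m x y hl hm => ?_
    obtain ⟨N, hN⟩ := H l x hl
    obtain ⟨M, hM⟩ := H m y hm
    exact List.prefix_or_prefix_of_prefix
      (hN.trans (flatten_replicate_prefix c (le_max_left N M)))
      (hM.trans (flatten_replicate_prefix c (le_max_right N M)))
  obtain ⟨j, hj⟩ := exists_forall_not_prefix S (fun l hl => (hS l hl).1) hc hdc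
  exact ⟨_, x, isPath_append.2 ⟨u, hcu.flatten_replicate j, hd⟩, hj⟩

/-! ### Words in the algebra and their independence from vertices -/

namespace LeavittPathAlgebra

variable {K : Type w} [Field K] {G : DirectedGraph V E} [Fintype V]

variable (K G) in
/-- The product of a list of edges. -/
noncomputable def word (l : List E) : LeavittPathAlgebra K G := (l.map (edge K G)).prod

variable (K G) in
/-- The product of the ghosts of a list of edges, in the reverse order. -/
noncomputable def ghostWord : List E → LeavittPathAlgebra K G
  | [] => 1
  | e :: l => ghostWord l * ghost K G e

theorem word_nil : word K G [] = 1 := rfl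

theorem word_cons (e : E) (l : List E) : word K G (e :: l) = edge K G e * word K G l := by
  simp [word]

theorem word_append (l m : List E) : word K G (l ++ m) = word K G l * word K G m := by
  simp [word]

theorem eq_zero_of_forall_mul_vertex {a : LeavittPathAlgebra K G}
    (h : ∀ u, a * vertex K G u = 0) : a = 0 := by
  rw [← mul_one a, one_def, Finset.mul_sum]
  exact Finset.sum_eq_zero fun u _ => h u

theorem eq_zero_of_forall_vertex_mul {a : LeavittPathAlgebra K G}
    (h : ∀ u, vertex K G u * a = 0) : a = 0 := by
  rw [← one_mul a, one_def, Finset.sum_mul]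
  exact Finset.sum_eq_zero fun u _ => h u

/-- As the empty word is `1`, a path from `u` is represented by `vertex K G u * word K G l`, not by
the word alone. -/
theorem vertex_mul_word {u x : V} {l : List E} (h : G.IsPath u l x) :
    vertex K G u * word K G l = word K G l * vertex K G x := by
  induction l generalizing u with
  | nil => obtain rfl : u = x := h; rw [word_nil, mul_one, one_mul]
  | cons e l ih =>
    obtain ⟨rfl, h⟩ := h
    rw [word_cons, ← mul_assoc, source_mul_edge, mul_assoc, ← ih h, ← mul_assoc, edge_mul_range]

theorem vertex_mul_word_mul_vertex {u x : V} {l : List E} (h : G.IsPath u l x) :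
    vertex K G u * word K G l * vertex K G x = vertex K G u * word K G l := by
  rw [vertex_mul_word h, mul_assoc, vertex_mul_self]

theorem vertex_mul_word_mul_vertex_eq_zero {u x : V} {l : List E} (h : ¬ G.IsPath u l x) :
    vertex K G u * word K G l * vertex K G x = 0 := by
  induction l generalizing u with
  | nil => rw [word_nil, mul_one, vertex_mul_vertex h]
  | cons e l ih =>
    by_cases hu : G.s e = u
    · subst hu
      rw [word_cons, ← mul_assoc, source_mul_edge, ← edge_mul_range, mul_assoc, mul_assoc,
        ← mul_assoc (vertex K G _), ih fun h' => h ⟨rfl, h'⟩, mul_zero]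
    · rw [word_cons, ← mul_assoc, vertex_mul_edge hu, zero_mul, zero_mul]

theorem ghostWord_mul_word {u x : V} {l : List E} (h : G.IsPath u l x) :
    ghostWord K G l * (vertex K G u * word K G l) = vertex K G x := by
  induction l generalizing u with
  | nil => obtain rfl : u = x := h; rw [word_nil, mul_one]; exact one_mul _
  | cons e l ih =>
    obtain ⟨rfl, h⟩ := h
    rw [word_cons, ← mul_assoc (vertex K G _), source_mul_edge, ghostWord, mul_assoc,
      ← mul_assoc (ghost K G e), ghost_mul_self, ih h]

theorem ghostWord_mul_word_append {u x : V} {l : List E} (h : G.IsPath u l x) (m : List E) :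
    ghostWord K G l * (vertex K G u * word K G (l ++ m)) = vertex K G x * word K G m := by
  rw [word_append, ← mul_assoc (vertex K G u), ← mul_assoc, ghostWord_mul_word h]

/-- Incomparable words differ at some first position, and there `e* f = 0`. -/
theorem ghostWord_mul_word_eq_zero {l m : List E} (h : ¬ l <+: m) (h' : ¬ m <+: l) (y : V) :
    ghostWord K G l * (vertex K G y * word K G m) = 0 := by
  induction l generalizing m y with
  | nil => exact absurd List.nil_prefix h
  | cons e l ih =>
    cases m with
    | nil => exact absurd List.nil_prefix h'
    | cons f m =>
      by_cases hy : G.s f = y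
      · subst hy
        rw [word_cons, ← mul_assoc (vertex K G _), source_mul_edge, ghostWord, mul_assoc,
          ← mul_assoc (ghost K G e)]
        by_cases hef : e = f
        · subst hef
          rw [ghost_mul_self]
          exact ih (fun h1 => h (List.cons_prefix_cons.2 ⟨rfl, h1⟩))
            (fun h1 => h' (List.cons_prefix_cons.2 ⟨rfl, h1⟩)) _
        · rw [ghost_mul_edge hef, zero_mul, mul_zero]
      · rw [word_cons, ← mul_assoc (vertex K G _), vertex_mul_edge hy, zero_mul, mul_zero]

variable (K G) in
/-- The span of the paths of positive length. -/
noncomputable def positiveSpan : Submodule K (LeavittPathAlgebra K G) :=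
  Submodule.span K {a | ∃ u l, l ≠ [] ∧ a = vertex K G u * word K G l}

/-- Apply the graded representation to the basis vector `(u, x₀, 0)`: `z` strictly raises degrees,
so the coefficient at that same vector is `k`. With `z = 0` this says that vertices are nonzero. -/
theorem eq_zero_of_smul_vertex_add_mem_positiveSpan {k : K} {u : V} {z : LeavittPathAlgebra K G}
    (hz : z ∈ positiveSpan K G) (h : k • vertex K G u + z = 0) : k = 0 := by
  obtain ⟨x₀, F, hF, hv, he⟩ := exists_gradedFamily K G
  let D : ℤ → Submodule K ((V × (E ⊕ ℕ) × ℤ) →₀ K) := fun j =>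
    Finsupp.supported K K {b | b.2.2 = j}
  have hD : ∀ (T : Module.End K ((V × (E ⊕ ℕ) × ℤ) →₀ K)) (i j : ℤ),
      (∀ b, T (Finsupp.single b 1) ∈ D (b.2.2 + i)) → ∀ m ∈ D j, T m ∈ D (j + i) := by
    intro T i j hT m hm
    simp only [D, Finsupp.supported_eq_span_single K {b : V × (E ⊕ ℕ) × ℤ | b.2.2 = j}] at hm
    induction hm using Submodule.span_induction with
    | mem m hm =>
      obtain ⟨b, rfl, rfl⟩ := hm
      exact hT b
    | zero => rw [map_zero]; exact zero_mem _
    | add m m' _ _ h h' => rw [map_add]; exact add_mem h h'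
    | smul c m _ h => rw [map_smul]; exact Submodule.smul_mem _ c h
  have hword : ∀ (l : List E) (y : V) (j : ℤ), ∀ m ∈ D j,
      F.lift K (vertex K G y * word K G l) m ∈ D (j + l.length) := by
    intro l
    induction l with
    | nil =>
      intro y j m hm
      rw [word_nil, mul_one, F.lift_vertex]
      exact hD _ 0 j (fun b => by rw [add_zero]; exact hv y b) m hm
    | cons e l ih =>
      intro y j m hm
      rw [word_cons, ← edge_mul_range, mul_assoc, ← mul_assoc, map_mul, map_mul, F.lift_vertex,
        F.lift_edge]
      have h1 := ih (G.r e) j m hm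
      have h2 := hD _ 1 _ (fun b => he e b) _ h1
      have h3 := hD _ 0 _ (fun b => by rw [add_zero]; exact hv y b) _ h2
      rw [add_zero, add_assoc] at h3
      simpa using h3
  have hz0 : F.lift K z (Finsupp.single (u, x₀, 0) 1) (u, x₀, 0) = 0 := by
    clear h
    induction hz using Submodule.span_induction with
    | mem z hz =>
      obtain ⟨y, l, hl, rfl⟩ := hz
      have := hword l y 0 (Finsupp.single (u, x₀, 0) 1) (Finsupp.single_mem_supported K 1 rfl)
      by_contra hne
      have h1 : ((0 : ℤ) = 0 + l.length) := this (Finsupp.mem_support_iff.2 hne)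
      have := List.length_pos_iff.2 hl
      omega
    | zero => simp
    | add a b _ _ ha hb =>
      rw [map_add, LinearMap.add_apply, Finsupp.add_apply, ha, hb, add_zero]
    | smul c a _ ha =>
      rw [map_smul, LinearMap.smul_apply, Finsupp.smul_apply, ha, smul_zero]
  have h1 := congrArg (fun a => F.lift K a (Finsupp.single (u, x₀, 0) 1) (u, x₀, 0)) h
  simp only [map_add, map_smul, map_zero, LinearMap.add_apply, Finsupp.add_apply, hz0,
    LinearMap.smul_apply, F.lift_vertex, hF, LinearMap.zero_apply] at h1
  simpa using h1

end LeavittPathAlgebra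

end DirectedGraph

/-! ### Reduction to a vertex plus closed paths -/

namespace DirectedGraph

variable {V : Type u} {E : Type v}

namespace LeavittPathAlgebra

variable {K : Type w} [Field K] {G : DirectedGraph V E} [Fintype V]

variable (K G) in
/-- The linear combinations of products of paths with at most `d` ghosts of edges, the ghosts being
on the right. -/
noncomputable def ghostFiltration : ℕ → Submodule K (LeavittPathAlgebra K G)
  | 0 => Submodule.span K (Set.range fun p : List E × V => word K G p.1 * vertex K G p.2)
  | d + 1 => ghostFiltration d ⊔
      Submodule.span K {b | ∃ a ∈ ghostFiltration d, ∃ f, b = a * ghost K G f}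

theorem word_mul_vertex_mem (l : List E) (x : V) :
    word K G l * vertex K G x ∈ ghostFiltration K G 0 :=
  Submodule.subset_span ⟨(l, x), rfl⟩

theorem ghostFiltration_le_succ (d : ℕ) : ghostFiltration K G d ≤ ghostFiltration K G (d + 1) :=
  le_sup_left

theorem ghostFiltration_mono : Monotone (ghostFiltration K G) :=
  monotone_nat_of_le_succ ghostFiltration_le_succ

theorem mul_ghost_mem {d : ℕ} {a : LeavittPathAlgebra K G} (ha : a ∈ ghostFiltration K G d)
    (f : E) : a * ghost K G f ∈ ghostFiltration K G (d + 1) :=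
  Submodule.mem_sup_right (Submodule.subset_span ⟨a, ha, f, rfl⟩)

theorem ghostFiltration_zero_induction
    {p : (a : LeavittPathAlgebra K G) → a ∈ ghostFiltration K G 0 → Prop}
    (word_mul : ∀ l x, p (word K G l * vertex K G x) (word_mul_vertex_mem l x))
    (zero : p 0 (zero_mem _))
    (add : ∀ a b ha hb, p a ha → p b hb → p (a + b) (add_mem ha hb))
    (smul : ∀ (c : K) a ha, p a ha → p (c • a) (Submodule.smul_mem _ c ha))
    {a : LeavittPathAlgebra K G} (ha : a ∈ ghostFiltration K G 0) : p a ha :=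
  Submodule.span_induction (p := p) (by rintro _ ⟨⟨l, x⟩, rfl⟩; exact word_mul l x) zero add smul ha

theorem ghostFiltration_succ_induction {d : ℕ}
    {p : (a : LeavittPathAlgebra K G) → a ∈ ghostFiltration K G (d + 1) → Prop}
    (mem : ∀ a (ha : a ∈ ghostFiltration K G d), p a (ghostFiltration_le_succ d ha))
    (mul_ghost : ∀ a (ha : a ∈ ghostFiltration K G d) f, p (a * ghost K G f) (mul_ghost_mem ha f))
    (add : ∀ a b ha hb, p a ha → p b hb → p (a + b) (add_mem ha hb))
    (smul : ∀ (c : K) a ha, p a ha → p (c • a) (Submodule.smul_mem _ c ha))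
    {a : LeavittPathAlgebra K G} (ha : a ∈ ghostFiltration K G (d + 1)) : p a ha := by
  obtain ⟨a, ha', b, hb, rfl⟩ := Submodule.mem_sup.1 ha
  suffices h : ∃ h, p b h from add a b _ h.choose (mem a ha') h.choose_spec
  clear ha ha'
  induction hb using Submodule.span_induction with
  | mem b h => obtain ⟨a, ha, f, rfl⟩ := h; exact ⟨_, mul_ghost a ha f⟩
  | zero => exact ⟨_, mem 0 (zero_mem _)⟩
  | add a b _ _ h h' =>
    obtain ⟨h, hp⟩ := h
    obtain ⟨h', hp'⟩ := h'
    exact ⟨_, add a b h h' hp hp'⟩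
  | smul c a _ h =>
    obtain ⟨h, hp⟩ := h
    exact ⟨_, smul c a h hp⟩

theorem mul_vertex_mem {d : ℕ} {a : LeavittPathAlgebra K G} (ha : a ∈ ghostFiltration K G d)
    (u : V) : a * vertex K G u ∈ ghostFiltration K G d := by
  induction d generalizing a with
  | zero =>
    induction ha using ghostFiltration_zero_induction with
    | word_mul l x =>
      by_cases hx : x = u
      · subst hx
        rw [mul_assoc, vertex_mul_self]
        exact word_mul_vertex_mem l x
      · rw [mul_assoc, vertex_mul_vertex hx, mul_zero]
        exact zero_mem _
    | zero => rw [zero_mul]; exact zero_mem _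
    | add a b _ _ ha hb => rw [add_mul]; exact add_mem ha hb
    | smul c a _ ha => rw [smul_mul_assoc]; exact Submodule.smul_mem _ c ha
  | succ d ih =>
    induction ha using ghostFiltration_succ_induction with
    | mem a ha => exact ghostFiltration_le_succ d (ih ha)
    | mul_ghost a ha f =>
      by_cases hf : G.s f = u
      · subst hf
        rw [mul_assoc, ghost_mul_source]
        exact mul_ghost_mem ha f
      · rw [mul_assoc, ghost_mul_vertex hf, mul_zero]
        exact zero_mem _
    | add a b _ _ ha hb => rw [add_mul]; exact add_mem ha hb
    | smul c a _ ha => rw [smul_mul_assoc]; exact Submodule.smul_mem _ c ha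

/-- The edge cancels a last ghost or gives zero. At level `0` the subtraction truncates: the edge is
absorbed into the path. -/
theorem mul_edge_mem {d : ℕ} {a : LeavittPathAlgebra K G} (ha : a ∈ ghostFiltration K G d)
    (e : E) : a * edge K G e ∈ ghostFiltration K G (d - 1) := by
  induction d generalizing a with
  | zero =>
    induction ha using ghostFiltration_zero_induction with
    | word_mul l x =>
      by_cases hx : G.s e = x
      · subst hx
        rw [mul_assoc, source_mul_edge, ← edge_mul_range, ← mul_assoc]
        have : word K G l * edge K G e = word K G (l ++ [e]) := by
          rw [word_append, word_cons, word_nil, mul_one]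
        rw [this]
        exact word_mul_vertex_mem _ _
      · rw [mul_assoc, vertex_mul_edge hx, mul_zero]
        exact zero_mem _
    | zero => rw [zero_mul]; exact zero_mem _
    | add a b _ _ ha hb => rw [add_mul]; exact add_mem ha hb
    | smul c a _ ha => rw [smul_mul_assoc]; exact Submodule.smul_mem _ c ha
  | succ d ih =>
    induction ha using ghostFiltration_succ_induction with
    | mem a ha => exact ghostFiltration_mono (by omega) (ih ha)
    | mul_ghost a ha f =>
      by_cases hf : f = e
      · subst hf
        rw [mul_assoc, ghost_mul_self]
        exact mul_vertex_mem ha _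
      · rw [mul_assoc, ghost_mul_edge hf, mul_zero]
        exact zero_mem _
    | add a b _ _ ha hb => rw [add_mul]; exact add_mem ha hb
    | smul c a _ ha => rw [smul_mul_assoc]; exact Submodule.smul_mem _ c ha

theorem mul_word_mem {d : ℕ} {a : LeavittPathAlgebra K G} (ha : a ∈ ghostFiltration K G d)
    (l : List E) : a * word K G l ∈ ghostFiltration K G (d - l.length) := by
  induction l generalizing d a with
  | nil => rwa [word_nil, mul_one]
  | cons e l ih =>
    rw [word_cons, ← mul_assoc]
    exact ghostFiltration_mono (by simp only [List.length_cons]; omega) (ih (mul_edge_mem ha e))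

theorem exists_mem_ghostFiltration (a : LeavittPathAlgebra K G) :
    ∃ d, a ∈ ghostFiltration K G d := by
  -- Stated for right multiplication of an arbitrary `b`, so that products of generators can be
  -- treated one factor at a time.
  have key : ∀ d, ∀ b ∈ ghostFiltration K G d, ∃ d', b * a ∈ ghostFiltration K G d' := by
    induction a using gen_induction with
    | gen g =>
      intro d b hb
      cases g with
      | vertex u => exact ⟨d, mul_vertex_mem hb u⟩
      | edge e => exact ⟨d - 1, mul_edge_mem hb e⟩
      | ghost e => exact ⟨d + 1, mul_ghost_mem hb e⟩
    | mul x y hx hy =>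
      intro d b hb
      obtain ⟨d, hd⟩ := hx d b hb
      rw [← mul_assoc]
      exact hy d _ hd
    | add x y hx hy =>
      intro d b hb
      obtain ⟨i, hi⟩ := hx d b hb
      obtain ⟨j, hj⟩ := hy d b hb
      rw [mul_add]
      exact ⟨max i j, add_mem (ghostFiltration_mono (le_max_left i j) hi)
        (ghostFiltration_mono (le_max_right i j) hj)⟩
    | smul c x hx =>
      intro d b hb
      obtain ⟨i, hi⟩ := hx d b hb
      rw [mul_smul_comm]
      exact ⟨i, Submodule.smul_mem _ c hi⟩
    | zero =>
      intro d b _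
      rw [mul_zero]
      exact ⟨0, zero_mem _⟩
  have h1 : (1 : LeavittPathAlgebra K G) ∈ ghostFiltration K G 0 := by
    rw [one_def]
    refine Submodule.sum_mem _ fun u _ => ?_
    simpa [word_nil] using word_mul_vertex_mem (K := K) (G := G) [] u
  simpa using key 0 1 h1

/-- Terms are grouped by their last ghost. Multiplying by an edge `f` on the right then isolates the
coefficient `β f`. -/
theorem exists_add_sum_mul_ghost {d : ℕ} {a : LeavittPathAlgebra K G}
    (ha : a ∈ ghostFiltration K G d) :
    ∃ b ∈ ghostFiltration K G 0, ∃ β : E →₀ LeavittPathAlgebra K G,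
      a = b + β.sum fun f c => c * ghost K G f := by
  induction d generalizing a with
  | zero => exact ⟨a, ha, 0, by simp⟩
  | succ d ih =>
    induction ha using ghostFiltration_succ_induction with
    | mem a ha => exact ih ha
    | mul_ghost a ha f => exact ⟨0, zero_mem _, Finsupp.single f a, by simp⟩
    | add a a' _ _ h h' =>
      obtain ⟨b, hb, β, rfl⟩ := h
      obtain ⟨b', hb', β', rfl⟩ := h'
      refine ⟨b + b', add_mem hb hb', β + β', ?_⟩
      rw [Finsupp.sum_add_index' (by simp) (by intros; rw [add_mul])]
      abel
    | smul k a _ h =>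
      obtain ⟨b, hb, β, rfl⟩ := h
      refine ⟨k • b, Submodule.smul_mem _ k hb, β.mapRange (k • ·) (smul_zero k), ?_⟩
      rw [Finsupp.sum_mapRange_index (by simp), smul_add, Finsupp.smul_sum]
      simp only [smul_mul_assoc]

variable (K G) in
/-- The span of the closed paths of positive length at the vertex `x`. -/
noncomputable def closedSpan (x : V) : Submodule K (LeavittPathAlgebra K G) :=
  Submodule.span K {a | ∃ l, l ≠ [] ∧ G.IsPath x l x ∧ a = vertex K G x * word K G l}

theorem vertex_mul_word_mul_vertex_mem (x : V) {l : List E} (hl : l ≠ []) :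
    vertex K G x * word K G l * vertex K G x ∈ closedSpan K G x := by
  by_cases h : G.IsPath x l x
  · rw [vertex_mul_word_mul_vertex h]
    exact Submodule.subset_span ⟨l, hl, h, rfl⟩
  · rw [vertex_mul_word_mul_vertex_eq_zero h]
    exact zero_mem _

/-- Multiply on the left by the ghost of a shortest path `l₀` from some `u` to `x` occurring in the
element. A path `l₀ m` to `x` becomes the closed path `m` at `x`; by minimality every other path is
incomparable with `l₀` and vanishes. -/
theorem exists_mul_mul_vertex_eq {b : LeavittPathAlgebra K G} (hb : b ∈ ghostFiltration K G 0)
    {x : V} (hx : b * vertex K G x ≠ 0) :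
    ∃ y, ∃ k : K, k ≠ 0 ∧ ∃ z ∈ closedSpan K G x,
      y * (b * vertex K G x) = k • vertex K G x + z := by
  classical
  -- Equal words are collected, so that a word in the support other than `l₀` leaves a nonempty
  -- remainder.
  obtain ⟨β, hβ⟩ : ∃ β : List E →₀ K,
      b * vertex K G x = β.sum fun l k => k • (word K G l * vertex K G x) := by
    clear hx
    induction hb using ghostFiltration_zero_induction with
    | word_mul l y =>
      by_cases hy : y = x
      · subst hy
        refine ⟨Finsupp.single l 1, ?_⟩
        simp [mul_assoc, vertex_mul_self]
      · refine ⟨0, ?_⟩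
        rw [mul_assoc, vertex_mul_vertex hy, mul_zero, Finsupp.sum_zero_index]
    | zero => exact ⟨0, by simp⟩
    | add a b _ _ ha hb =>
      obtain ⟨β, hβ⟩ := ha
      obtain ⟨γ, hγ⟩ := hb
      refine ⟨β + γ, ?_⟩
      rw [add_mul, hβ, hγ, Finsupp.sum_add_index' (by simp) (by intros; rw [add_smul])]
    | smul c a _ ha =>
      obtain ⟨β, hβ⟩ := ha
      refine ⟨c • β, ?_⟩
      rw [smul_mul_assoc, hβ, Finsupp.sum_smul_index (by simp), Finsupp.smul_sum]
      simp only [mul_smul]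
  obtain ⟨u, hu⟩ : ∃ u, vertex K G u * (b * vertex K G x) ≠ 0 := by
    by_contra! H
    exact hx (eq_zero_of_forall_vertex_mul H)
  have hsum : vertex K G u * (b * vertex K G x) =
      ∑ l ∈ β.support, β l • (vertex K G u * word K G l * vertex K G x) := by
    rw [hβ, Finsupp.sum, Finset.mul_sum]
    simp only [mul_smul_comm, mul_assoc]
  have hne : (β.support.filter fun l => G.IsPath u l x).Nonempty := by
    by_contra H
    rw [Finset.not_nonempty_iff_eq_empty, Finset.filter_eq_empty_iff] at H
    refine hu (hsum.trans (Finset.sum_eq_zero fun l hl => ?_))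
    rw [vertex_mul_word_mul_vertex_eq_zero (H hl), smul_zero]
  obtain ⟨l₀, hl₀, hmin⟩ := Finset.exists_min_image _ List.length hne
  obtain ⟨hl₀β, hl₀p⟩ := Finset.mem_filter.1 hl₀
  refine ⟨ghostWord K G l₀ * vertex K G u, β l₀, Finsupp.mem_support_iff.1 hl₀β,
    ∑ l ∈ β.support.erase l₀,
      ghostWord K G l₀ * (β l • (vertex K G u * word K G l * vertex K G x)), ?_, ?_⟩
  · refine Submodule.sum_mem _ fun l hl => ?_
    obtain ⟨hne, hl⟩ := Finset.mem_erase.1 hl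
    rw [mul_smul_comm]
    refine Submodule.smul_mem _ _ ?_
    by_cases hp : G.IsPath u l x
    · have hlen := hmin l (Finset.mem_filter.2 ⟨hl, hp⟩)
      by_cases hpre : l₀ <+: l
      · obtain ⟨m, rfl⟩ := hpre
        rw [← mul_assoc, ghostWord_mul_word_append hl₀p]
        refine vertex_mul_word_mul_vertex_mem x ?_
        rintro rfl
        exact hne (List.append_nil l₀)
      · rw [← mul_assoc, ghostWord_mul_word_eq_zero hpre
          (fun h => hne (h.eq_of_length_le hlen)), zero_mul]
        exact zero_mem _
    · rw [vertex_mul_word_mul_vertex_eq_zero hp, mul_zero]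
      exact zero_mem _
  · rw [mul_assoc, hsum, Finset.mul_sum, ← Finset.add_sum_erase _ _ hl₀β, mul_smul_comm,
      vertex_mul_word_mul_vertex hl₀p, ghostWord_mul_word hl₀p]

/-- Otherwise `b s(f)` reduces to `k s(f) + z` with `k ≠ 0`. Compressing by `f` gives `k r(f) + f* z
f = 0`, where `f* z f` is still a combination of paths of positive length, so `k = 0`. -/
theorem mul_source_eq_zero {b : LeavittPathAlgebra K G} (hb : b ∈ ghostFiltration K G 0)
    {f : E} (hf : b * edge K G f = 0) : b * vertex K G (G.s f) = 0 := by
  by_contra hne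
  obtain ⟨y, k, hk, z, hz, h⟩ := exists_mul_mul_vertex_eq hb hne
  have h1 := congrArg (fun a => ghost K G f * (a * edge K G f)) h
  rw [mul_assoc, mul_assoc, source_mul_edge, hf, mul_zero, mul_zero, add_mul, smul_mul_assoc,
    source_mul_edge, mul_add, mul_smul_comm, ghost_mul_self] at h1
  refine hk (eq_zero_of_smul_vertex_add_mem_positiveSpan ?_ h1.symm)
  clear h h1
  induction hz using Submodule.span_induction with
  | mem z hz =>
    obtain ⟨l, hl, hp, rfl⟩ := hz
    cases l with
    | nil => exact absurd rfl hl
    | cons e l =>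
      rw [word_cons, ← hp.1, ← mul_assoc (vertex K G _), source_mul_edge, mul_assoc, ← mul_assoc]
      by_cases hef : f = e
      · subst hef
        rw [ghost_mul_self]
        refine Submodule.subset_span ⟨G.r f, l ++ [f], by simp, ?_⟩
        rw [word_append, word_cons, word_nil, mul_one]
      · rw [ghost_mul_edge hef, zero_mul]
        exact zero_mem _
  | zero => rw [zero_mul, mul_zero]; exact zero_mem _
  | add a b _ _ ha hb => rw [add_mul, mul_add]; exact add_mem ha hb
  | smul c a _ ha => rw [smul_mul_assoc, mul_smul_comm]; exact Submodule.smul_mem _ c ha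

/-- An edge `f` with `a f ≠ 0` lowers the ghost level. If there is none, pick `u` with `a u ≠ 0`: at
a sink the ghost terms die against `u`; at a regular vertex `a u = ∑ a f f* = 0`; at an infinite
emitter `a u = 0` as well. -/
theorem exists_mul_mem_ghostFiltration_zero {a : LeavittPathAlgebra K G} (ha : a ≠ 0) :
    ∃ x, a * x ∈ ghostFiltration K G 0 ∧ a * x ≠ 0 := by
  obtain ⟨d, hd⟩ := exists_mem_ghostFiltration a
  induction d generalizing a with
  | zero => exact ⟨1, by rwa [mul_one], by rwa [mul_one]⟩
  | succ d ih =>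
    by_cases H : ∃ f, a * edge K G f ≠ 0
    · obtain ⟨f, hf⟩ := H
      obtain ⟨x, hx, hx'⟩ := ih hf (mul_edge_mem hd f)
      exact ⟨edge K G f * x, by rwa [← mul_assoc], by rwa [← mul_assoc]⟩
    push Not at H
    obtain ⟨u, hu⟩ : ∃ u, a * vertex K G u ≠ 0 := by
      by_contra! H'
      exact ha (eq_zero_of_forall_mul_vertex H')
    obtain ⟨b, hb, β, rfl⟩ := exists_add_sum_mul_ghost hd
    rcases Set.eq_empty_or_nonempty {e : E | G.s e = u} with hempty | hne
    · have h0 : (β.sum fun f c => c * ghost K G f) * vertex K G u = 0 := by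
        rw [Finsupp.sum, Finset.sum_mul]
        refine Finset.sum_eq_zero fun f _ => ?_
        rw [mul_assoc, ghost_mul_vertex (fun h => ?_), mul_zero]
        exact Set.eq_empty_iff_forall_notMem.1 hempty f h
      refine ⟨vertex K G u, ?_, hu⟩
      rw [add_mul, h0, add_zero]
      exact mul_vertex_mem hb u
    · exfalso
      by_cases hfin : {e : E | G.s e = u}.Finite
      · refine hu ?_
        rw [vertex_eq_sum u hfin hne, Finset.mul_sum]
        refine Finset.sum_eq_zero fun f _ => ?_
        rw [← mul_assoc, H, zero_mul]
      · classical
        have hβ : ∀ f, (β.sum fun f c => c * ghost K G f) * edge K G f =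
            β f * vertex K G (G.r f) := by
          intro f
          rw [Finsupp.sum, Finset.sum_mul, Finset.sum_eq_single f]
          · rw [mul_assoc, ghost_mul_self]
          · intro g _ hg
            rw [mul_assoc, ghost_mul_edge hg, mul_zero]
          · intro hf
            rw [Finsupp.notMem_support_iff.1 hf, zero_mul, zero_mul]
        -- An edge from `u` outside the support of `β` meets only the ghost-free part, so `b f = 0`
        -- and hence `b u = 0`. Then `β g r(g) = 0` for every edge `g` from `u`.
        obtain ⟨f, hfu, hf⟩ := (Set.Infinite.sdiff hfin β.support.finite_toSet).nonempty
        have hfu : G.s f = u := hfu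
        have hbf := H f
        rw [add_mul, hβ, Finsupp.notMem_support_iff.1 hf, zero_mul, add_zero] at hbf
        have hbu := mul_source_eq_zero hb hbf
        rw [hfu] at hbu
        refine hu ?_
        rw [add_mul, hbu, zero_add, Finsupp.sum, Finset.sum_mul]
        refine Finset.sum_eq_zero fun g _ => ?_
        by_cases hg : G.s g = u
        · have h := H g
          rw [add_mul, hβ, ← source_mul_edge, ← mul_assoc, hg, hbu, zero_mul, zero_add] at h
          rw [← range_mul_ghost, ← mul_assoc, h, zero_mul, zero_mul]
        · rw [mul_assoc, ghost_mul_vertex hg, mul_zero]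

/-- At a vertex where paths branch, the closed paths can be removed. -/
theorem exists_mul_mul_eq_vertex {u : V} (hu : ¬ G.NonBranching u)
    {z : LeavittPathAlgebra K G} (hz : z ∈ closedSpan K G u) (k : K) :
    ∃ x, ∃ a b : LeavittPathAlgebra K G, a * (k • vertex K G u + z) * b = k • vertex K G x := by
  classical
  -- `S` collects the closed paths `l` occurring in `z`. The compression of `l` by `d` vanishes as
  -- soon as `d` is not a prefix of `l ++ d`, the opposite inclusion being excluded by length.
  obtain ⟨S, hS, hSz⟩ : ∃ S : Finset (List E), (∀ l ∈ S, l ≠ [] ∧ G.IsPath u l u) ∧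
      ∀ d, (∀ l ∈ S, ¬ d <+: l ++ d) → ghostWord K G d * z * word K G d = 0 := by
    induction hz using Submodule.span_induction with
    | mem z hz =>
      obtain ⟨l, hl, hp, rfl⟩ := hz
      refine ⟨{l}, by simpa using ⟨hl, hp⟩, fun d hd => ?_⟩
      have hd := hd l (Finset.mem_singleton_self l)
      rw [mul_assoc, mul_assoc, ← word_append]
      refine ghostWord_mul_word_eq_zero hd (fun h => hd ?_) u
      rw [h.eq_of_length_le (by simp)]
    | zero => exact ⟨∅, by simp, by simp⟩
    | add a b _ _ ha hb =>
      obtain ⟨S, hS, hSa⟩ := ha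
      obtain ⟨T, hT, hTb⟩ := hb
      refine ⟨S ∪ T, fun l hl => (Finset.mem_union.1 hl).elim (hS l) (hT l), fun d hd => ?_⟩
      rw [mul_add, add_mul, hSa d fun l hl => hd l (Finset.mem_union_left T hl),
        hTb d fun l hl => hd l (Finset.mem_union_right S hl), add_zero]
    | smul c a _ ha =>
      obtain ⟨S, hS, hSa⟩ := ha
      refine ⟨S, hS, fun d hd => ?_⟩
      rw [mul_smul_comm, smul_mul_assoc, hSa d hd, smul_zero]
  obtain ⟨d, x, hd, hdS⟩ := exists_isPath_forall_not_prefix hu S hS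
  refine ⟨x, ghostWord K G d, word K G d, ?_⟩
  rw [mul_add, add_mul, hSz d hdS, add_zero, mul_smul_comm, smul_mul_assoc, mul_assoc,
    ghostWord_mul_word hd]

end LeavittPathAlgebra

end DirectedGraph

/-! ### The corner at a cycle without exits, and injectivity -/

namespace DirectedGraph

variable {V : Type u} {E : Type v}

namespace LeavittPathAlgebra

variable {K : Type w} [Field K] {G : DirectedGraph V E} [Fintype V]

open Polynomial

variable (K G) in
/-- The evaluation of polynomials at the element `t`, multiplied by the vertex `u`. -/
noncomputable def cornerEval (u : V) (t : LeavittPathAlgebra K G) :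
    K[X] →ₗ[K] LeavittPathAlgebra K G :=
  LinearMap.mulLeft K (vertex K G u) ∘ₗ (aeval t).toLinearMap

theorem cornerEval_apply (u : V) (t : LeavittPathAlgebra K G) (q : K[X]) :
    cornerEval K G u t q = vertex K G u * aeval t q := rfl

theorem cornerEval_one (u : V) (t : LeavittPathAlgebra K G) :
    cornerEval K G u t 1 = vertex K G u := by
  rw [cornerEval_apply, map_one, mul_one]

theorem cornerEval_C (u : V) (t : LeavittPathAlgebra K G) (k : K) :
    cornerEval K G u t (C k) = k • vertex K G u := by
  rw [← mul_one (C k), ← smul_eq_C_mul, map_smul, cornerEval_one]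

theorem cornerEval_mul {u : V} {t : LeavittPathAlgebra K G} (h : Commute (vertex K G u) t)
    (p q : K[X]) : cornerEval K G u t (p * q) = cornerEval K G u t p * cornerEval K G u t q := by
  have hc : Commute (vertex K G u) (aeval t p) := by
    induction p using Polynomial.induction_on' with
    | add p q hp hq => rw [map_add]; exact hp.add_right hq
    | monomial n a =>
      rw [aeval_monomial]
      exact (Algebra.commute_algebraMap_right a _).mul_right (h.pow_right n)
  rw [cornerEval_apply, cornerEval_apply, cornerEval_apply, map_mul, mul_assoc,
    ← mul_assoc (aeval t p), ← hc.eq, ← mul_assoc, ← mul_assoc, ← mul_assoc, vertex_mul_self]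

section Cycle

theorem commute_vertex_word {u : V} {c : List E} (hc : G.IsPath u c u) :
    Commute (vertex K G u) (word K G c) := vertex_mul_word hc

theorem word_flatten_replicate (c : List E) (N : ℕ) :
    word K G (List.replicate N c).flatten = word K G c ^ N := by
  induction N with
  | zero => rw [pow_zero]; rfl
  | succ N ih => rw [List.replicate_succ, List.flatten_cons, word_append, ih, pow_succ']

theorem cornerEval_X_pow (u : V) (c : List E) (N : ℕ) :
    cornerEval K G u (word K G c) (X ^ N) =
      vertex K G u * word K G (List.replicate N c).flatten := by
  rw [cornerEval_apply, word_flatten_replicate, map_pow, aeval_X]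

theorem cornerEval_X_mul_mem (u : V) {c : List E} (hc0 : c ≠ []) (q : K[X]) :
    cornerEval K G u (word K G c) (X * q) ∈ positiveSpan K G := by
  induction q using Polynomial.induction_on' with
  | add p q hp hq => rw [mul_add, map_add]; exact add_mem hp hq
  | monomial n a =>
    have : (X : K[X]) * monomial n a = a • X ^ (n + 1) := by
      rw [X_mul_monomial, ← C_mul_X_pow_eq_monomial, smul_eq_C_mul]
    rw [this, map_smul, cornerEval_X_pow]
    refine Submodule.smul_mem _ a (Submodule.subset_span ⟨u, _, ?_, rfl⟩)
    rw [List.replicate_succ, List.flatten_cons]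
    exact fun h => hc0 (List.append_eq_nil_iff.1 h).1

/-- Write `q = X ^ m * p` with `p(0) ≠ 0`. The ghost of `c ^ m` cancels the first factor, leaving
`p(0) u` plus paths of positive length. -/
theorem cornerEval_injective {u : V} {c : List E} (hc : G.IsPath u c u)
    (hc0 : c ≠ []) :
    Function.Injective (cornerEval K G u (word K G c)) := by
  rw [injective_iff_map_eq_zero]
  intro q hq
  by_contra hq0
  obtain ⟨p, hp, hp0⟩ := exists_eq_pow_rootMultiplicity_mul_and_not_dvd q hq0 0
  rw [C_0, sub_zero] at hp hp0
  rw [X_dvd_iff] at hp0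
  generalize rootMultiplicity 0 q = m at hp
  subst hp
  rw [cornerEval_mul (commute_vertex_word hc), cornerEval_X_pow] at hq
  have h1 := congrArg (ghostWord K G (List.replicate m c).flatten * ·) hq
  simp only [mul_zero] at h1
  rw [← mul_assoc, ghostWord_mul_word (hc.flatten_replicate m), cornerEval_apply, ← mul_assoc,
    vertex_mul_self, ← cornerEval_apply, ← divX_mul_X_add p, map_add, add_comm, cornerEval_C,
    mul_comm] at h1
  exact hp0 (eq_zero_of_smul_vertex_add_mem_positiveSpan (cornerEval_X_mul_mem u hc0 _) h1)

theorem vertex_mul_mul_vertex_mem_range {u : V} {c : List E}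
    (hcyc : ∀ m, G.IsPath u m u → ∃ N, m = (List.replicate N c).flatten)
    {b : LeavittPathAlgebra K G}
    (hb : b ∈ ghostFiltration K G 0) :
    vertex K G u * b * vertex K G u ∈ LinearMap.range (cornerEval K G u (word K G c)) := by
  induction hb using ghostFiltration_zero_induction with
  | word_mul l x =>
    by_cases hx : x = u
    · subst hx
      rw [← mul_assoc, mul_assoc, vertex_mul_self]
      by_cases hl : G.IsPath x l x
      · obtain ⟨N, rfl⟩ := hcyc l hl
        rw [vertex_mul_word_mul_vertex hl, ← cornerEval_X_pow]
        exact LinearMap.mem_range_self _ _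
      · rw [vertex_mul_word_mul_vertex_eq_zero hl]
        exact zero_mem _
    · rw [mul_assoc, mul_assoc, vertex_mul_vertex hx, mul_zero, mul_zero]
      exact zero_mem _
  | zero => rw [mul_zero, zero_mul]; exact zero_mem _
  | add a b _ _ ha hb => rw [mul_add, add_mul]; exact add_mem ha hb
  | smul k a _ ha => rw [mul_smul_comm, smul_mul_assoc]; exact Submodule.smul_mem _ k ha

theorem exists_cornerEval_eq_of_mem_closedSpan {u : V} {c : List E}
    (hcyc : ∀ m, G.IsPath u m u → ∃ N, m = (List.replicate N c).flatten)
    {z : LeavittPathAlgebra K G}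
    (hz : z ∈ closedSpan K G u) : ∃ q : K[X], cornerEval K G u (word K G c) (X * q) = z := by
  induction hz using Submodule.span_induction with
  | mem z hz =>
    obtain ⟨l, hl, hp, rfl⟩ := hz
    obtain ⟨N, rfl⟩ := hcyc l hp
    cases N with
    | zero => exact absurd rfl hl
    | succ N => exact ⟨X ^ N, by rw [← pow_succ', cornerEval_X_pow]⟩
  | zero => exact ⟨0, by rw [mul_zero, map_zero]⟩
  | add a b _ _ ha hb =>
    obtain ⟨p, rfl⟩ := ha
    obtain ⟨q, rfl⟩ := hb
    exact ⟨p + q, by rw [mul_add, map_add]⟩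
  | smul k a _ ha =>
    obtain ⟨p, rfl⟩ := ha
    exact ⟨k • p, by rw [mul_smul_comm, map_smul]⟩

/-- Every value is already taken at a remainder modulo `f`. -/
theorem finite_range_cornerEval {u : V} {t : LeavittPathAlgebra K G}
    (h : Commute (vertex K G u) t) {f : K[X]} (hf : f ≠ 0) (hft : cornerEval K G u t f = 0) :
    Module.Finite K (LinearMap.range (cornerEval K G u t)) := by
  have hle : LinearMap.range (cornerEval K G u t) ≤
      LinearMap.range (cornerEval K G u t ∘ₗ (degreeLT K f.natDegree).subtype) := by
    rintro _ ⟨q, rfl⟩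
    refine ⟨⟨q % f, ?_⟩, ?_⟩
    · rw [mem_degreeLT, ← degree_eq_natDegree hf]
      exact EuclideanDomain.mod_lt q hf
    · conv_rhs => rw [← EuclideanDomain.div_add_mod q f, map_add, cornerEval_mul h, hft, zero_mul,
        zero_add]
      rfl
  exact Submodule.finiteDimensional_of_le hle

/-- At a vertex of a cycle without exits, a surjective endomorphism preserving the vertices kills
no polynomial in the cycle with nonzero constant coefficient. -/
theorem cornerEval_map_ne_zero {u : V} {c : List E} (hc : G.IsPath u c u)
    (hcyc : ∀ m, G.IsPath u m u → ∃ N, m = (List.replicate N c).flatten)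
    (hc0 : c ≠ [])
    {φ : LeavittPathAlgebra K G →ₐ[K] LeavittPathAlgebra K G} (hφ : Function.Surjective φ)
    (hφu : φ (vertex K G u) = vertex K G u) {f : K[X]} (hf : f.coeff 0 ≠ 0) :
    φ (cornerEval K G u (word K G c) f) ≠ 0 := by
  intro hzero
  have hcomm : Commute (vertex K G u) (word K G c) := commute_vertex_word hc
  have ht : Commute (vertex K G u) (φ (word K G c)) := by
    have := hcomm.map φ
    rwa [hφu] at this
  have hmap : ∀ q, φ (cornerEval K G u (word K G c) q) = cornerEval K G u (φ (word K G c)) q := by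
    intro q
    rw [cornerEval_apply, cornerEval_apply, map_mul, hφu, aeval_algHom_apply]
  rw [hmap] at hzero
  have hf0 : f ≠ 0 := by
    rintro rfl
    exact hf (coeff_zero 0)
  -- Solving `f(t) = 0` for its constant term, with `t = φ(c)`, shows that `t` is invertible in the
  -- corner, with inverse a polynomial `s` in `t`.
  obtain ⟨s, hs⟩ : ∃ s, cornerEval K G u (φ (word K G c)) (X * s) = vertex K G u := by
    refine ⟨-(f.coeff 0)⁻¹ • f.divX, ?_⟩
    have h1 : X * (-(f.coeff 0)⁻¹ • f.divX) = 1 - (f.coeff 0)⁻¹ • f := by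
      have h2 := divX_mul_X_add f
      generalize f.coeff 0 = k at hf h2 ⊢
      conv_rhs => rw [← h2]
      rw [smul_add, smul_C, smul_eq_mul, inv_mul_cancel₀ hf, C_1, mul_smul_comm, neg_smul,
        mul_comm X]
      abel
    rw [h1, map_sub, map_smul, hzero, smul_zero, sub_zero, cornerEval_one]
  have hsN : ∀ N, cornerEval K G u (φ (word K G c)) (X ^ N * s ^ N) = vertex K G u := by
    intro N
    induction N with
    | zero => rw [pow_zero, pow_zero, mul_one, cornerEval_one]
    | succ N ih =>
      rw [← mul_pow, pow_succ, mul_pow, cornerEval_mul ht, ih, hs, vertex_mul_self]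
  -- The whole corner consists of polynomials in `φ(c)`: for a preimage `a`, the product `u a u c ^
  -- d` has no ghosts left (`c ^ d` has length at least `d`), so it is a polynomial in `c`; apply
  -- `φ` and divide by `φ(c) ^ d`.
  have hmem : ∀ a, vertex K G u * a * vertex K G u ∈
      LinearMap.range (cornerEval K G u (φ (word K G c))) := by
    intro a
    obtain ⟨a, rfl⟩ := hφ a
    obtain ⟨d, hd⟩ := exists_mem_ghostFiltration (vertex K G u * a * vertex K G u)
    have h1 := mul_word_mem hd (List.replicate d c).flatten
    have hlen : d - (List.replicate d c).flatten.length = 0 := by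
      have := List.length_pos_iff.2 hc0
      simp only [List.length_flatten, List.map_replicate, List.sum_replicate, smul_eq_mul]
      exact Nat.sub_eq_zero_of_le (Nat.le_mul_of_pos_right _ this)
    rw [hlen] at h1
    obtain ⟨q, hq⟩ := vertex_mul_mul_vertex_mem_range hcyc h1
    have h2 : vertex K G u * (vertex K G u * a * vertex K G u *
        word K G (List.replicate d c).flatten) * vertex K G u =
        vertex K G u * a * cornerEval K G u (word K G c) (X ^ d) := by
      rw [cornerEval_X_pow, mul_assoc (vertex K G u * a), vertex_mul_word (hc.flatten_replicate d)]
      simp only [← mul_assoc, vertex_mul_self]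
      rw [mul_assoc _ (vertex K G u) (vertex K G u), vertex_mul_self]
    rw [h2] at hq
    have h3 := congrArg φ hq
    rw [hmap, map_mul, map_mul, hmap, hφu] at h3
    refine ⟨q * s ^ d, ?_⟩
    rw [cornerEval_mul ht, h3, mul_assoc, ← cornerEval_mul ht, hsN]
  have hle : LinearMap.range (cornerEval K G u (word K G c)) ≤
      LinearMap.range (cornerEval K G u (φ (word K G c))) := by
    rintro _ ⟨q, rfl⟩
    have h1 := hmem (cornerEval K G u (word K G c) q)
    rwa [← cornerEval_one u (word K G c), ← cornerEval_mul hcomm, ← cornerEval_mul hcomm, one_mul,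
      mul_one] at h1
  -- The polynomials in `φ(c)` form a finite-dimensional space containing an injective image of
  -- `K[X]`.
  have := finite_range_cornerEval ht hf0 hzero
  have := Submodule.finiteDimensional_of_le hle
  exact Polynomial.not_finite (R := K) (Module.Finite.equiv
    (LinearEquiv.ofInjective _ (cornerEval_injective (K := K) hc hc0)).symm)

end Cycle

/-- A surjective endomorphism of a Leavitt path algebra that preserves the vertices is
injective. -/
theorem injective_of_surjective {φ : LeavittPathAlgebra K G →ₐ[K] LeavittPathAlgebra K G}
    (hφ : Function.Surjective φ) (hφv : ∀ u, φ (vertex K G u) = vertex K G u) :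
    Function.Injective φ := by
  rw [injective_iff_map_eq_zero]
  intro a ha
  by_contra ha0
  obtain ⟨x, hx, hx0⟩ := exists_mul_mem_ghostFiltration_zero ha0
  obtain ⟨u, hu⟩ : ∃ u, a * x * vertex K G u ≠ 0 := by
    by_contra! H
    exact hx0 (eq_zero_of_forall_mul_vertex H)
  obtain ⟨y, k, hk, z, hz, h⟩ := exists_mul_mul_vertex_eq hx hu
  have hker : φ (k • vertex K G u + z) = 0 := by
    rw [← h, map_mul, map_mul, map_mul, ha, zero_mul, zero_mul, mul_zero]
  have hvertex : ∀ x, φ (k • vertex K G x) ≠ 0 := by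
    intro x hx
    rw [map_smul, hφv] at hx
    exact hk (eq_zero_of_smul_vertex_add_mem_positiveSpan (zero_mem _) ((add_zero _).trans hx))
  by_cases hbr : G.NonBranching u
  · by_cases hl : ∃ l, l ≠ [] ∧ G.IsPath u l u
    · obtain ⟨l, hl, hlu⟩ := hl
      obtain ⟨c, hc0, hc, hcyc⟩ := hbr.exists_cycle hl hlu
      obtain ⟨q, rfl⟩ := exists_cornerEval_eq_of_mem_closedSpan hcyc hz
      refine cornerEval_map_ne_zero hc hcyc hc0 hφ (hφv u) (f := C k + X * q) (by simpa) ?_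
      rwa [map_add, cornerEval_C]
    -- Without closed paths at `u` the term `z` is zero.
    · have hbot : closedSpan K G u = ⊥ := by
        rw [closedSpan, Submodule.span_eq_bot]
        rintro _ ⟨l, hl0, hlu, -⟩
        exact absurd ⟨l, hl0, hlu⟩ hl
      rw [hbot, Submodule.mem_bot] at hz
      rw [hz, add_zero] at hker
      exact hvertex u hker
  · obtain ⟨x, b, c, hbc⟩ := exists_mul_mul_eq_vertex hbr hz k
    refine hvertex x ?_
    rw [← hbc, map_mul, map_mul, hker, mul_zero, zero_mul]

end LeavittPathAlgebra

end DirectedGraph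

/-! ### The theorem -/

theorem mainTheorem4 {K : Type*} [Field K] {V : Type*} {E : Type*} [Fintype V]
    (G : DirectedGraph V E) (n : ℕ) (hn : 0 < n) (v w : V)
    (e : Fin n → E) (he : Function.Injective e)
    (hs : ∀ i, G.s (e i) = v) (hr : ∀ i, G.r (e i) = w)
    (P : (Matrix (Fin n) (Fin n) (DirectedGraph.LeavittPathAlgebra K G))ˣ)
    (hP : ∀ i j, DirectedGraph.LeavittPathAlgebra.vertex K G w * P.val i j =
      P.val i j * DirectedGraph.LeavittPathAlgebra.vertex K G w) :
    (∃ φ : DirectedGraph.LeavittPathAlgebra K G →ₐ[K] DirectedGraph.LeavittPathAlgebra K G,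
      DirectedGraph.LeavittPathAlgebra.IsMatrixTwist K G e P.val P⁻¹.val φ ∧
      ∀ ψ : DirectedGraph.LeavittPathAlgebra K G →ₙₐ[K] DirectedGraph.LeavittPathAlgebra K G,
        DirectedGraph.LeavittPathAlgebra.IsMatrixTwist K G e P.val P⁻¹.val ψ → ∀ x, ψ x = φ x) ∧
    (∀ φ : DirectedGraph.LeavittPathAlgebra K G →ₐ[K] DirectedGraph.LeavittPathAlgebra K G,
      DirectedGraph.LeavittPathAlgebra.IsMatrixTwist K G e P.val P⁻¹.val φ →
      (∀ i j, φ (P.val i j) = P.val i j) →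
      ∃ σ : DirectedGraph.LeavittPathAlgebra K G ≃ₐ[K] DirectedGraph.LeavittPathAlgebra K G,
        (∀ x, σ x = φ x) ∧
        DirectedGraph.LeavittPathAlgebra.IsMatrixTwist K G e P⁻¹.val P.val σ.symm) := by
  classical
  -- The hypothesis says that `P` commutes with the scalar matrix `w`; hence so does `P⁻¹`.
  have hcomm : Commute (Matrix.diagonal fun _ => DirectedGraph.LeavittPathAlgebra.vertex K G w)
      P.val := by
    refine Matrix.ext fun i j => ?_
    rw [Matrix.diagonal_mul, Matrix.mul_diagonal]
    exact hP i j
  have hQ : ∀ i j, DirectedGraph.LeavittPathAlgebra.vertex K G w * P⁻¹.val i j =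
      P⁻¹.val i j * DirectedGraph.LeavittPathAlgebra.vertex K G w := by
    intro i j
    have := congrFun (congrFun hcomm.units_inv_right.eq i) j
    rwa [Matrix.diagonal_mul, Matrix.mul_diagonal] at this
  constructor
  · obtain ⟨φ, hφ⟩ := DirectedGraph.LeavittPathAlgebra.exists_isMatrixTwist he hs hr P.val P⁻¹.val
      P.mul_inv P.inv_mul hP hQ
    exact ⟨φ, hφ, fun ψ hψ => hψ.ext (φ := ψ) (ψ := (φ : _ →ₙₐ[K] _)) hφ⟩
  · intro φ hφ hφP
    obtain ⟨ψ, hψ⟩ := DirectedGraph.LeavittPathAlgebra.exists_isMatrixTwist he hs hr P⁻¹.val P.val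
      P.inv_mul P.mul_inv hQ hP
    -- This makes `ψ` a right inverse of `φ`; once `φ` is known to be injective, `ψ` is its
    -- two-sided inverse.
    have hid := hφ.comp_eq_id P.mul_inv P.inv_mul hψ hφP
    have hsurj : Function.Surjective φ := fun x => ⟨ψ x, hid x⟩
    have hinj := DirectedGraph.LeavittPathAlgebra.injective_of_surjective hsurj hφ.map_vertex
    refine ⟨AlgEquiv.ofBijective φ ⟨hinj, hsurj⟩, fun x => rfl, ?_⟩
    have hsymm : ⇑(AlgEquiv.ofBijective φ ⟨hinj, hsurj⟩).symm = ψ := by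
      funext x
      rw [AlgEquiv.symm_apply_eq]
      exact (hid x).symm
    rw [hsymm]
    exact hψ
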